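/- **Setting.** Let $\Lambda=\bigoplus_{i\ge 0}\Lambda_i$ be an $\mathbb N$-graded ring whose degree-zero part $\Lambda_0$ is semisimple. Modules are right modules; $\mathrm{Gr}\text{-}\Lambda$ is the category of $\mathbb Z$-graded right $\Lambda$-modules with degree-preserving homomorphisms, and $M(k)$ denotes the shift, $M(k)_n=M_{n+k}$. A graded module $M$ is *Koszul* if it is generated in degree $0$ and has a minimal graded projective resolution $\cdots\to P_1\to P_0\to M\to 0$ with each $P_n$ generated in degree $n$. For $M$ generated in degree $0$, the *syzygy* $\Omega M$ is the kernel of the projective cover $M_0\otimes_{\Lambda_0}\Lambda\to M$; a morphism $f\colon M\to N$ of such modules lifts uniquely to the projective covers, and $\Omega(f)$ is the restriction of the lift to $\Omega M\to\Omega N$. Let $F=\Omega(-)(1)$, an endofunctor of the category of Koszul modules. A ring $R$ with pairwise orthogonal idempotents $e_1,\dots,e_r$ satisfying $\sum_i e_i=1$ is a *piecewise domain with respect to $\{e_i\}$* if, for all $i,j,\ell$, $x\in e_iRe_j$ and $y\in e_jRe_\ell$ with $xy=0$ implies $x=0$ or $y=0$. A ring $R\neq 0$ is *prime* if $aRb=0$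 implies $a=0$ or $b=0$. **Theorem.** Let $r\ge 1$, let $S_1,\dots,S_r$ be Koszul simple right $\Lambda$-modules (not necessarily distinct), let $M=S_1\oplus\cdots\oplus S_r$, let $\mathrm{Ext}^\bullet_\Lambda(M,M)=\bigoplus_{n\ge 0}\mathrm{Ext}^n_\Lambda(M,M)$ be the Ext ring with the Yoneda product (computed in the category of all right $\Lambda$-modules), and let $e_1,\dots,e_r\in\mathrm{End}_\Lambda(M)=\mathrm{Ext}^0_\Lambda(M,M)$ be the idempotents of this decomposition. Consider the conditions: (a) $\mathrm{Ext}^\bullet_\Lambda(M,M)$ is a piecewise domain with respect to $\{e_i\}$; (b) for all $i\ge 0$, all $\ell,m$ and every nonzero morphism $f\colon F^i(S_\ell)\to S_m$ in $\mathrm{Gr}\text{-}\Lambda$, the morphisms $F^j(f)$ are surjective for all $j\ge 0$; (c) for all $i\ge 0$, all $\ell,m$ and every nonzero morphism $f\colon F^i(S_\ell)\to S_m$ in $\mathrm{Gr}\text{-}\Lambda$, the module $\ker f$ is Koszul. 1. Suppose that, for all $j\ge 0$ and all $m$, every simple graded quotient of $F^j(S_m)$ is isomorphic to some $S_p$ (this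 holds, for instance, if every simple graded right $\Lambda$-module concentrated in degree $0$ is isomorphic to some $S_p$). Then (a), (b) and (c) are equivalent. Without this supposition, (b) and (c) are still equivalent to each other and imply (a). 2. If (a) holds, and for any $\ell\neq m$ there exists $i\ge 0$ such that $\mathrm{Hom}_{\mathrm{Gr}\text{-}\Lambda}(F^i(S_\ell),S_m)\neq 0$, then $\mathrm{Ext}^\bullet_\Lambda(M,M)$ is prime. -/

import Mathlib

open CategoryTheory

universe u

noncomputable section

namespace KoszulExt

/-! ### Graded right modules

A right `Λ`-module is a module over `Λᵐᵒᵖ`, so `MulOpposite.op a • x` stands for `x a`. -/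

/-- A `ℤ`-graded right module over the `ℕ`-graded ring `Λ = ⨁ 𝒜 i`. -/
structure GrMod {Λ : Type u} [Ring Λ] (𝒜 : ℕ → AddSubgroup Λ) where
  carrier : Type u
  [addCommGroup : AddCommGroup carrier]
  [module : Module Λᵐᵒᵖ carrier]
  grade : ℤ → AddSubgroup carrier
  isInternal : DirectSum.IsInternal grade
  smul_mem : ∀ {i : ℕ} {n : ℤ} {a : Λ} {x : carrier}, a ∈ 𝒜 i → x ∈ grade n →
    MulOpposite.op a • x ∈ grade (n + i)

attribute [instance] GrMod.addCommGroup GrMod.module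

namespace GrMod

variable {Λ : Type u} [Ring Λ] {𝒜 : ℕ → AddSubgroup Λ}

/-- Degree-preserving homomorphisms of graded right modules. -/
@[ext]
structure Hom (M N : GrMod 𝒜) where
  toLin : M.carrier →ₗ[Λᵐᵒᵖ] N.carrier
  map_mem : ∀ (n : ℤ) (x : M.carrier), x ∈ M.grade n → toLin x ∈ N.grade n

/-- The category of graded right modules. -/
instance : Category (GrMod 𝒜) where
  Hom := Hom
  id M := ⟨LinearMap.id, fun _ _ h => h⟩
  comp f g := ⟨g.toLin ∘ₗ f.toLin, fun n x h => g.map_mem n _ (f.map_mem n x h)⟩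

/-- The underlying linear map of a morphism. -/
def lin {M N : GrMod 𝒜} (f : M ⟶ N) : M.carrier →ₗ[Λᵐᵒᵖ] N.carrier := Hom.toLin f

theorem lin_mem {M N : GrMod 𝒜} (f : M ⟶ N) {n : ℤ} {x : M.carrier} (h : x ∈ M.grade n) :
    lin f x ∈ N.grade n := Hom.map_mem f n x h

theorem hom_ext {M N : GrMod 𝒜} {f g : M ⟶ N} (h : ∀ x, lin f x = lin g x) : f = g :=
  Hom.ext (LinearMap.ext h)

@[simp] theorem lin_id (M : GrMod 𝒜) (x : M.carrier) : lin (𝟙 M) x = x := rfl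

@[simp] theorem lin_comp {M N P : GrMod 𝒜} (f : M ⟶ N) (g : N ⟶ P) (x : M.carrier) :
    lin (f ≫ g) x = lin g (lin f x) := rfl

/-- A morphism is surjective when its underlying map is. -/
def Surj {M N : GrMod 𝒜} (f : M ⟶ N) : Prop := Function.Surjective (lin f)

/-- A morphism is nonzero when its underlying map is. -/
def Nonzero {M N : GrMod 𝒜} (f : M ⟶ N) : Prop := lin f ≠ 0

/-- `M` is generated, as a right `Λ`-module, by its component of degree `n`. -/
def GeneratedIn (M : GrMod 𝒜) (n : ℤ) : Prop :=
  Submodule.span Λᵐᵒᵖ (M.grade n : Set M.carrier) = ⊤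

/-- Projective objects of the category of graded modules: morphisms from `P` lift along every
surjective morphism. -/
def IsProjective (P : GrMod 𝒜) : Prop :=
  ∀ (X Y : GrMod 𝒜) (g : X ⟶ Y) (f : P ⟶ Y), Surj g → ∃ h : P ⟶ X, h ≫ g = f

/-- `⋯ ⟶ P 2 ⟶ P 1 ⟶ P 0 ⟶ M ⟶ 0` is a minimal graded projective resolution: it is exact, every
`P n` is projective, and each `P n` is a projective cover of its image, that is, a morphism `g`
into `P n` is surjective as soon as its composite with the map from `P n` onto that image is. -/
structure IsMinimalResolution (M : GrMod 𝒜) (P : ℕ → GrMod 𝒜)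
    (d : ∀ n, P (n + 1) ⟶ P n) (ε : P 0 ⟶ M) : Prop where
  projective : ∀ n, IsProjective (P n)
  surj : Surj ε
  exact_zero : LinearMap.range (lin (d 0)) = LinearMap.ker (lin ε)
  exact_succ : ∀ n, LinearMap.range (lin (d (n + 1))) = LinearMap.ker (lin (d n))
  minimal_zero : ∀ (X : GrMod 𝒜) (g : X ⟶ P 0), Surj (g ≫ ε) → Surj g
  minimal_succ : ∀ (n : ℕ) (X : GrMod 𝒜) (g : X ⟶ P (n + 1)),
    LinearMap.range (lin (g ≫ d n)) = LinearMap.range (lin (d n)) → Surj g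

/-- Koszul modules: generated in degree `0`, with a minimal graded projective resolution whose
`n`th term is generated in degree `n`. -/
def IsKoszul (M : GrMod 𝒜) : Prop :=
  M.GeneratedIn 0 ∧ ∃ (P : ℕ → GrMod 𝒜) (d : ∀ n, P (n + 1) ⟶ P n) (ε : P 0 ⟶ M),
    IsMinimalResolution M P d ε ∧ ∀ n : ℕ, (P n).GeneratedIn n

/-! ### Homogeneous components, kernels and shifts -/

theorem isInternal_of_proj {M : Type u} [AddCommGroup M] (ℳ : ℤ → AddSubgroup M)
    (p : ℤ → M →+ M) (h1 : ∀ n x, x ∈ ℳ n → p n x = x)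
    (h2 : ∀ m n x, m ≠ n → x ∈ ℳ m → p n x = 0)
    (h3 : ∀ x, x ∈ ⨆ n, ℳ n) : DirectSum.IsInternal ℳ := by
  classical
  have key : ∀ (n : ℤ) (x : DirectSum ℤ fun i => ℳ i),
      p n (DirectSum.coeAddMonoidHom ℳ x) = x n := by
    intro n x
    induction x using DirectSum.induction_on with
    | zero => simp
    | of i x =>
      rw [DirectSum.coeAddMonoidHom_of]
      by_cases h : i = n
      · subst h
        rw [h1 _ _ x.2, DirectSum.of_eq_same]
      · rw [h2 _ _ _ h x.2, DirectSum.of_eq_of_ne _ _ _ (Ne.symm h)]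
        rfl
    | add x y hx hy => rw [map_add, map_add, hx, hy]; rfl
  constructor
  · intro x y hxy
    refine DFinsupp.ext fun n => Subtype.ext ?_
    rw [← key, ← key, hxy]
  · intro x
    have hx := h3 x
    rw [← AddMonoidHom.mem_range]
    refine (iSup_le (fun n => ?_) : (⨆ n, ℳ n) ≤ (DirectSum.coeAddMonoidHom ℳ).range) hx
    intro y hy
    exact ⟨DirectSum.of (fun i => ℳ i) n ⟨y, hy⟩, DirectSum.coeAddMonoidHom_of _ _ _⟩

/-- The component of degree `n` of an element of a graded module. -/
def component (M : GrMod 𝒜) (n : ℤ) : M.carrier →+ M.carrier :=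
  letI := M.isInternal.chooseDecomposition
  { toFun := fun x => (DirectSum.decompose M.grade x n : M.carrier)
    map_zero' := by simp
    map_add' := by intro x y; simp }

theorem component_mem (M : GrMod 𝒜) (n : ℤ) (x : M.carrier) : M.component n x ∈ M.grade n :=
  letI := M.isInternal.chooseDecomposition
  (DirectSum.decompose M.grade x n).2

theorem component_same (M : GrMod 𝒜) (n : ℤ) (x : M.carrier) (hx : x ∈ M.grade n) :
    M.component n x = x :=
  letI := M.isInternal.chooseDecomposition
  DirectSum.decompose_of_mem_same M.grade hx

theorem component_ne (M : GrMod 𝒜) (m n : ℤ) (x : M.carrier) (h : m ≠ n) (hx : x ∈ M.grade m) :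
    M.component n x = 0 :=
  letI := M.isInternal.chooseDecomposition
  DirectSum.decompose_of_mem_ne M.grade hx h

theorem exists_sum_component (M : GrMod 𝒜) (x : M.carrier) :
    ∃ s : Finset ℤ, ∑ n ∈ s, M.component n x = x := by
  classical
  let := M.isInternal.chooseDecomposition
  exact ⟨_, DirectSum.sum_support_decompose M.grade x⟩

theorem lin_component {M N : GrMod 𝒜} (f : M ⟶ N) (n : ℤ) (x : M.carrier) :
    lin f (M.component n x) = N.component n (lin f x) := by
  obtain ⟨s, hs⟩ := M.exists_sum_component x
  have hy : ∀ y : M.carrier, ∀ m, y ∈ M.grade m →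
      lin f (M.component n y) = N.component n (lin f y) := by
    intro y m hm
    by_cases h : m = n
    · subst h
      rw [component_same _ _ _ hm, component_same _ _ _ (lin_mem f hm)]
    · rw [component_ne _ _ _ _ h hm, component_ne _ _ _ _ h (lin_mem f hm), map_zero]
  rw [← hs, map_sum, map_sum, map_sum, map_sum]
  exact Finset.sum_congr rfl fun m _ => hy _ m (M.component_mem m x)

/-- The kernel of a morphism of graded modules, as a graded module. -/
def ker {M N : GrMod 𝒜} (f : M ⟶ N) : GrMod 𝒜 where
  carrier := LinearMap.ker (lin f)
  grade n := (M.grade n).comap (LinearMap.ker (lin f)).subtype.toAddMonoidHom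
  isInternal := by
    have hk : ∀ (n : ℤ) (x : LinearMap.ker (lin f)), M.component n x ∈ LinearMap.ker (lin f) := by
      intro n x
      rw [LinearMap.mem_ker, lin_component, LinearMap.mem_ker.1 x.2, map_zero]
    refine isInternal_of_proj _
      (fun n => { toFun := fun x => ⟨M.component n x, hk n x⟩
                  map_zero' := by ext; simp
                  map_add' := by intro x y; ext; simp }) ?_ ?_ ?_
    · intro n x hx
      exact Subtype.ext (M.component_same n _ hx)
    · intro m n x h hx
      exact Subtype.ext (M.component_ne m n _ h hx)
    · intro x
      obtain ⟨s, hs⟩ := M.exists_sum_component x.1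
      have : x = ∑ n ∈ s, (⟨M.component n x, hk n x⟩ : LinearMap.ker (lin f)) := by
        ext
        simpa using hs.symm
      rw [this]
      refine AddSubgroup.sum_mem _ fun n _ => ?_
      exact (le_iSup (fun n => (M.grade n).comap (LinearMap.ker (lin f)).subtype.toAddMonoidHom) n)
        (M.component_mem n x)
  smul_mem := fun ha hx => M.smul_mem ha hx

/-- The shift `M(k)`, with `M(k)_n = M_{n + k}`. -/
def shift (M : GrMod 𝒜) (k : ℤ) : GrMod 𝒜 where
  carrier := M.carrier
  grade n := M.grade (n + k)
  isInternal := by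
    refine isInternal_of_proj _ (fun n => M.component (n + k)) ?_ ?_ ?_
    · intro n x hx
      exact M.component_same _ _ hx
    · intro m n x h hx
      exact M.component_ne _ _ _ (by lia) hx
    · intro x
      obtain ⟨s, hs⟩ := M.exists_sum_component x
      rw [← hs]
      refine AddSubgroup.sum_mem _ fun n _ => ?_
      refine (le_iSup (fun n => M.grade (n + k)) (n - k)) ?_
      simpa using M.component_mem n x
  smul_mem := by
    intro i n a x ha hx
    have := M.smul_mem ha hx
    rwa [show n + k + i = n + i + k by ring] at this

/-! ### The module `M₀ ⊗_S Λ`, where `S = Λ₀` -/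

/-- `M₀ ⊗_ℤ Λ` (with the factors interchanged) as a right `Λ`-module. -/
abbrev PreTensor (M : GrMod 𝒜) : Type u := TensorProduct ℤ Λ (M.grade 0)

/-- The right action of `Λ₀` on `M₀`. -/
def degreeZeroSMul (M : GrMod 𝒜) (s : 𝒜 0) (m : M.grade 0) : M.grade 0 :=
  ⟨MulOpposite.op (s : Λ) • (m : M.carrier), by simpa using M.smul_mem s.2 m.2⟩

/-- The relations `m s ⊗ a = m ⊗ s a` for `m ∈ M₀`, `s ∈ Λ₀`, `a ∈ Λ`. -/
def balancing (M : GrMod 𝒜) : Submodule Λᵐᵒᵖ (PreTensor M) :=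
  Submodule.span Λᵐᵒᵖ {t | ∃ (s : 𝒜 0) (a : Λ) (m : M.grade 0),
    t = ((s : Λ) * a) ⊗ₜ[ℤ] m - a ⊗ₜ[ℤ] M.degreeZeroSMul s m}

/-- The underlying right `Λ`-module of `M₀ ⊗_S Λ`. -/
abbrev Tensor (M : GrMod 𝒜) : Type u := PreTensor M ⧸ M.balancing

/-- The element `m ⊗ a` of `M₀ ⊗_S Λ`. -/
def tmk (M : GrMod 𝒜) (m : M.grade 0) (a : Λ) : Tensor M :=
  M.balancing.mkQ (a ⊗ₜ[ℤ] m)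

theorem smul_tmk (M : GrMod 𝒜) (m : M.grade 0) (a b : Λ) :
    MulOpposite.op b • M.tmk m a = M.tmk m (a * b) := rfl

/-- The component of degree `n` of `M₀ ⊗_S Λ`, spanned by the `m ⊗ a` with `a ∈ Λ_n`. -/
def tensorGrade (M : GrMod 𝒜) (n : ℤ) : AddSubgroup (Tensor M) :=
  AddSubgroup.closure {t | ∃ (i : ℕ) (a : Λ) (m : M.grade 0), (i : ℤ) = n ∧ a ∈ 𝒜 i ∧
    t = M.tmk m a}

theorem tensor_induction {M : GrMod 𝒜} {p : Tensor M → Prop} (h0 : p 0)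
    (ht : ∀ m a, p (M.tmk m a)) (ha : ∀ x y, p x → p y → p (x + y)) (x : Tensor M) : p x := by
  obtain ⟨t, rfl⟩ := M.balancing.mkQ_surjective x
  induction t using TensorProduct.induction_on with
  | zero => simpa using h0
  | tmul a m => exact ht m a
  | add x y hx hy => rw [map_add]; exact ha _ _ hx hy

/-- Additive maps out of `M₀ ⊗_S Λ` from additive maps of `M₀ ⊗_ℤ Λ` that respect the relations. -/
def tensorLift (M : GrMod 𝒜) {A : Type u} [AddCommGroup A] (f : PreTensor M →+ A)
    (hf : ∀ t ∈ M.balancing, f t = 0) : Tensor M →+ A :=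
  QuotientAddGroup.lift M.balancing.toAddSubgroup f hf

theorem tensorLift_tmk (M : GrMod 𝒜) {A : Type u} [AddCommGroup A] (f : PreTensor M →+ A)
    (hf : ∀ t ∈ M.balancing, f t = 0) (m : M.grade 0) (a : Λ) :
    M.tensorLift f hf (M.tmk m a) = f (a ⊗ₜ[ℤ] m) := rfl

section

variable [GradedRing 𝒜]

/-- The component of degree `n` of an element of `Λ`, for an integer `n`. -/
def ringComponent (n : ℤ) : Λ →+ Λ :=
  if 0 ≤ n then GradedRing.proj 𝒜 n.toNat else 0

theorem ringComponent_mul (n : ℤ) (s : 𝒜 0) (a : Λ) :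
    ringComponent (𝒜 := 𝒜) n ((s : Λ) * a) = s * ringComponent (𝒜 := 𝒜) n a := by
  unfold ringComponent
  split_ifs
  · simp only [GradedRing.proj_apply]
    exact DirectSum.coe_decompose_mul_of_left_mem_zero 𝒜 s.2
  · simp

theorem ringComponent_same (i : ℕ) (a : Λ) (ha : a ∈ 𝒜 i) :
    ringComponent (𝒜 := 𝒜) (i : ℤ) a = a := by
  unfold ringComponent
  rw [if_pos (by positivity)]
  simpa using DirectSum.decompose_of_mem_same 𝒜 ha

theorem ringComponent_ne (i : ℕ) (n : ℤ) (h : (i : ℤ) ≠ n) (a : Λ) (ha : a ∈ 𝒜 i) :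
    ringComponent (𝒜 := 𝒜) n a = 0 := by
  unfold ringComponent
  split_ifs with h0
  · simpa using DirectSum.decompose_of_mem_ne 𝒜 ha (show i ≠ n.toNat by lia)
  · rfl

/-- The projection of `M₀ ⊗_S Λ` onto its component of degree `n`. -/
def tensorComponent (M : GrMod 𝒜) (n : ℤ) : Tensor M →+ Tensor M :=
  M.tensorLift (M.balancing.mkQ.toAddMonoidHom.comp
    (LinearMap.rTensor (M.grade 0) (ringComponent (𝒜 := 𝒜) n).toIntLinearMap).toAddMonoidHom) (by
      intro t ht
      induction ht using Submodule.closure_induction with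
      | zero => simp
      | add x y _ _ hx hy => rw [map_add, hx, hy, add_zero]
      | smul_mem r x hx =>
        obtain ⟨s, a, m, rfl⟩ := hx
        have h1 : r • (((s : Λ) * a) ⊗ₜ[ℤ] m - a ⊗ₜ[ℤ] M.degreeZeroSMul s m) =
            ((s : Λ) * (a * r.unop)) ⊗ₜ[ℤ] m - (a * r.unop) ⊗ₜ[ℤ] M.degreeZeroSMul s m := by
          rw [smul_sub, TensorProduct.smul_tmul', TensorProduct.smul_tmul', ← mul_assoc]
          rfl
        rw [h1]
        simp only [AddMonoidHom.comp_apply, LinearMap.toAddMonoidHom_coe, map_sub,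
          LinearMap.rTensor_tmul, AddMonoidHom.coe_toIntLinearMap, ringComponent_mul]
        rw [← map_sub, Submodule.mkQ_apply, Submodule.Quotient.mk_eq_zero]
        exact Submodule.subset_span ⟨s, _, m, rfl⟩)

theorem tensorComponent_tmk (M : GrMod 𝒜) (n : ℤ) (m : M.grade 0) (a : Λ) :
    M.tensorComponent n (M.tmk m a) = M.tmk m (ringComponent (𝒜 := 𝒜) n a) := rfl

/-- The graded right module `M₀ ⊗_S Λ`. -/
def cover (M : GrMod 𝒜) : GrMod 𝒜 where
  carrier := Tensor M
  grade := M.tensorGrade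
  isInternal := by
    classical
    refine isInternal_of_proj _ M.tensorComponent ?_ ?_ ?_
    · intro n x hx
      induction hx using AddSubgroup.closure_induction with
      | mem x hx =>
        obtain ⟨i, a, m, rfl, ha, rfl⟩ := hx
        rw [tensorComponent_tmk, ringComponent_same _ _ ha]
      | zero => simp
      | add x y _ _ hx hy => rw [map_add, hx, hy]
      | neg x _ hx => rw [map_neg, hx]
    · intro k n x h hx
      induction hx using AddSubgroup.closure_induction with
      | mem x hx =>
        obtain ⟨i, a, m, rfl, ha, rfl⟩ := hx
        rw [tensorComponent_tmk, ringComponent_ne _ _ h _ ha]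
        simp [tmk]
      | zero => simp
      | add x y _ _ hx hy => rw [map_add, hx, hy, add_zero]
      | neg x _ hx => rw [map_neg, hx, neg_zero]
    · intro x
      induction x using tensor_induction with
      | h0 => exact zero_mem _
      | ha x y hx hy => exact add_mem hx hy
      | ht m a =>
        rw [← DirectSum.sum_support_decompose 𝒜 a]
        have : M.tmk m (∑ i ∈ (DirectSum.decompose 𝒜 a).support, (DirectSum.decompose 𝒜 a i : Λ)) =
            ∑ i ∈ (DirectSum.decompose 𝒜 a).support,
              M.tmk m (DirectSum.decompose 𝒜 a i : Λ) := by
          simp only [tmk, TensorProduct.sum_tmul, map_sum]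
        rw [this]
        refine AddSubgroup.sum_mem _ fun i _ => ?_
        exact (le_iSup M.tensorGrade (i : ℤ)) (AddSubgroup.subset_closure
          ⟨i, _, m, rfl, (DirectSum.decompose 𝒜 a i).2, rfl⟩)
  smul_mem := by
    intro i n a x ha hx
    induction hx using AddSubgroup.closure_induction with
    | mem x hx =>
      obtain ⟨j, b, m, rfl, hb, rfl⟩ := hx
      exact AddSubgroup.subset_closure
        ⟨j + i, b * a, m, by push_cast; rfl, SetLike.mul_mem_graded hb ha, rfl⟩
    | zero => rw [smul_zero]; exact zero_mem _
    | add x y _ _ hx hy => rw [smul_add]; exact add_mem hx hy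
    | neg x _ hx => rw [smul_neg]; exact neg_mem hx

/-- The element `m ⊗ a` of the graded module `M₀ ⊗_S Λ`. -/
def coverTmk (M : GrMod 𝒜) (m : M.grade 0) (a : Λ) : M.cover.carrier := M.tmk m a

theorem cover_hom_ext {M N : GrMod 𝒜} {f g : M.cover ⟶ N}
    (h : ∀ m a, lin f (M.coverTmk m a) = lin g (M.coverTmk m a)) : f = g :=
  hom_ext fun x => tensor_induction (p := fun x : Tensor M => lin f x = lin g x)
    ((map_zero (lin f)).trans (map_zero (lin g)).symm) h
    (fun x y hx hy => ((lin f).map_add x y).trans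
      ((congrArg₂ (· + ·) hx hy).trans ((lin g).map_add x y).symm)) x

/-- The additive map `M₀ ⊗_ℤ Λ → A`, `m ⊗ a ↦ f(m) a`. -/
def preDesc (M : GrMod 𝒜) {A : Type u} [AddCommGroup A] [Module Λᵐᵒᵖ A] (f : M.grade 0 →+ A) :
    PreTensor M →ₗ[ℤ] A :=
  TensorProduct.lift (AddMonoidHom.toIntLinearMap
    { toFun := fun a => AddMonoidHom.toIntLinearMap
        ((DistribSMul.toAddMonoidHom A (MulOpposite.op a)).comp f)
      map_zero' := by ext m; simp
      map_add' := by intro a b; ext m; simp [add_smul] })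

theorem preDesc_tmul (M : GrMod 𝒜) {A : Type u} [AddCommGroup A] [Module Λᵐᵒᵖ A]
    (f : M.grade 0 →+ A) (m : M.grade 0) (a : Λ) :
    M.preDesc f (a ⊗ₜ[ℤ] m) = MulOpposite.op a • f m := rfl

theorem preDesc_smul (M : GrMod 𝒜) {A : Type u} [AddCommGroup A] [Module Λᵐᵒᵖ A]
    (f : M.grade 0 →+ A) (r : Λᵐᵒᵖ) (x : PreTensor M) :
    M.preDesc f (r • x) = r • M.preDesc f x := by
  induction x using TensorProduct.induction_on with
  | zero => simp
  | tmul a m =>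
    rw [TensorProduct.smul_tmul', preDesc_tmul, preDesc_tmul, ← mul_smul]
    rfl
  | add x y hx hy => rw [smul_add, map_add, hx, hy, map_add, smul_add]

/-- The right `Λ`-linear map `M₀ ⊗_S Λ → A`, `m ⊗ a ↦ f(m) a`, for a right `S`-linear map `f` from
`M₀` to a right `Λ`-module `A`. -/
def tensorDesc (M : GrMod 𝒜) {A : Type u} [AddCommGroup A] [Module Λᵐᵒᵖ A] (f : M.grade 0 →+ A)
    (hf : ∀ (s : 𝒜 0) (m : M.grade 0),
      f (M.degreeZeroSMul s m) = MulOpposite.op (s : Λ) • f m) : Tensor M →ₗ[Λᵐᵒᵖ] A :=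
  M.balancing.liftQ
    { toFun := M.preDesc f
      map_add' := map_add _
      map_smul' := M.preDesc_smul f } (by
    rw [balancing, Submodule.span_le]
    rintro _ ⟨s, a, m, rfl⟩
    change M.preDesc f _ = 0
    rw [map_sub, preDesc_tmul, preDesc_tmul, hf, ← mul_smul, MulOpposite.op_mul, sub_self])

theorem tensorDesc_tmk (M : GrMod 𝒜) {A : Type u} [AddCommGroup A] [Module Λᵐᵒᵖ A]
    (f : M.grade 0 →+ A) (hf) (m : M.grade 0) (a : Λ) :
    M.tensorDesc f hf (M.tmk m a) = MulOpposite.op a • f m := rfl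

/-- The morphism `M₀ ⊗_S Λ ⟶ N`, `m ⊗ a ↦ f(m) a`, for a right `S`-linear map `f : M₀ → N₀`. -/
def coverDesc {M N : GrMod 𝒜} (f : M.grade 0 →+ N.grade 0)
    (hf : ∀ (s : 𝒜 0) (m : M.grade 0),
      f (M.degreeZeroSMul s m) = N.degreeZeroSMul s (f m)) : M.cover ⟶ N :=
  Hom.mk (M.tensorDesc ((N.grade 0).subtype.comp f)
    (fun s m => congrArg Subtype.val (hf s m))) (by
    intro n x hx
    suffices h : ∀ t : Tensor M, t ∈ M.tensorGrade n →
        M.tensorDesc ((N.grade 0).subtype.comp f)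
          (fun s m => congrArg Subtype.val (hf s m)) t ∈ N.grade n from h x hx
    intro t ht
    induction ht using AddSubgroup.closure_induction with
    | mem x hx =>
      obtain ⟨i, a, m, rfl, ha, rfl⟩ := hx
      have h := N.smul_mem ha (f m).2
      rw [zero_add] at h
      exact h
    | zero => rw [map_zero]; exact zero_mem _
    | add x y _ _ hx hy => rw [map_add]; exact add_mem hx hy
    | neg x _ hx => rw [map_neg]; exact neg_mem hx)

theorem coverDesc_tmk {M N : GrMod 𝒜} (f : M.grade 0 →+ N.grade 0) (hf) (m : M.grade 0) (a : Λ) :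
    lin (coverDesc f hf) (M.coverTmk m a) = MulOpposite.op a • (f m : N.carrier) :=
  M.tensorDesc_tmk ((N.grade 0).subtype.comp f) (fun s m => congrArg Subtype.val (hf s m)) m a

/-- The morphism `M₀ ⊗_S Λ ⟶ M`, `m ⊗ a ↦ m a`. If `S = Λ₀` is semisimple and `M` is generated in
degree `0`, this is the projective cover of `M`. -/
def coverπ (M : GrMod 𝒜) : M.cover ⟶ M :=
  coverDesc (AddMonoidHom.id _) (fun _ _ => rfl)

theorem coverπ_tmk (M : GrMod 𝒜) (m : M.grade 0) (a : Λ) :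
    lin M.coverπ (M.coverTmk m a) = MulOpposite.op a • (m : M.carrier) :=
  coverDesc_tmk _ _ _ _

/-- The restriction of a morphism to the components of degree `0`. -/
def degreeZeroMap {M N : GrMod 𝒜} (f : M ⟶ N) : M.grade 0 →+ N.grade 0 where
  toFun m := ⟨lin f m, lin_mem f m.2⟩
  map_zero' := by ext; simp
  map_add' := by intro x y; ext; simp

/-- The map `m ↦ m ⊗ 1` from `M₀` to the component of degree `0` of `M₀ ⊗_S Λ`. -/
def coverUnit (M : GrMod 𝒜) : M.grade 0 →+ M.cover.grade 0 where
  toFun m := ⟨M.coverTmk m 1, AddSubgroup.subset_closure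
    ⟨0, 1, m, rfl, SetLike.one_mem_graded 𝒜, rfl⟩⟩
  map_zero' := Subtype.ext (show M.tmk 0 1 = 0 by rw [tmk, TensorProduct.tmul_zero, map_zero])
  map_add' x y := Subtype.ext (show M.tmk (x + y) 1 = M.tmk x 1 + M.tmk y 1 by
    rw [tmk, TensorProduct.tmul_add, map_add]; rfl)

theorem coverUnit_smul (M : GrMod 𝒜) (s : 𝒜 0) (m : M.grade 0) :
    M.coverUnit (M.degreeZeroSMul s m) = M.cover.degreeZeroSMul s (M.coverUnit m) := by
  refine Subtype.ext (show M.tmk (M.degreeZeroSMul s m) 1 =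
    MulOpposite.op (s : Λ) • M.tmk m 1 from ?_)
  rw [smul_tmk, one_mul, eq_comm, ← sub_eq_zero, tmk, tmk, ← map_sub, Submodule.mkQ_apply,
    Submodule.Quotient.mk_eq_zero]
  exact Submodule.subset_span ⟨s, 1, m, by rw [mul_one]⟩

/-- The morphism `f₀ ⊗ Λ : M₀ ⊗_S Λ ⟶ N₀ ⊗_S Λ`, which is the lift of `f` to the covers. -/
def coverMap {M N : GrMod 𝒜} (f : M ⟶ N) : M.cover ⟶ N.cover :=
  coverDesc (N.coverUnit.comp (degreeZeroMap f)) (by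
    intro s m
    have h : degreeZeroMap f (M.degreeZeroSMul s m) = N.degreeZeroSMul s (degreeZeroMap f m) :=
      Subtype.ext ((lin f).map_smul _ _)
    rw [AddMonoidHom.comp_apply, h, coverUnit_smul]
    rfl)

theorem coverMap_tmk {M N : GrMod 𝒜} (f : M ⟶ N) (m : M.grade 0) (a : Λ) :
    lin (coverMap f) (M.coverTmk m a) = N.coverTmk (degreeZeroMap f m) a := by
  refine (coverDesc_tmk _ _ _ _).trans
    (show MulOpposite.op a • N.tmk (degreeZeroMap f m) 1 = N.tmk (degreeZeroMap f m) a from ?_)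
  rw [smul_tmk, one_mul]

theorem coverπ_naturality {M N : GrMod 𝒜} (f : M ⟶ N) :
    coverMap f ≫ N.coverπ = M.coverπ ≫ f := by
  refine cover_hom_ext fun m a => ?_
  rw [lin_comp, lin_comp, coverMap_tmk, coverπ_tmk, coverπ_tmk, map_smul]
  rfl

theorem coverMap_id (M : GrMod 𝒜) : coverMap (𝟙 M) = 𝟙 M.cover :=
  cover_hom_ext fun m a => by rw [coverMap_tmk]; rfl

theorem coverMap_comp {M N P : GrMod 𝒜} (f : M ⟶ N) (g : N ⟶ P) :
    coverMap (f ≫ g) = coverMap f ≫ coverMap g :=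
  cover_hom_ext fun m a => by
    rw [lin_comp, coverMap_tmk, coverMap_tmk, coverMap_tmk]; rfl

/-! If `S` is semisimple and `M` is generated in degree `0`, then `M₀ ⊗_S Λ ⟶ M` is a projective
cover: its source is projective, it is surjective, and it is an essential epimorphism. -/

/-- The component `M₀` as a right `Λ₀`-module. -/
@[reducible]
def modZero (M : GrMod 𝒜) : Module (𝒜 0)ᵐᵒᵖ (M.grade 0) where
  smul s m := M.degreeZeroSMul s.unop m
  one_smul m := Subtype.ext (one_smul Λᵐᵒᵖ (m : M.carrier))
  mul_smul s t m := Subtype.ext (mul_smul (MulOpposite.op (s.unop : Λ))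
    (MulOpposite.op (t.unop : Λ)) (m : M.carrier))
  smul_zero _ := Subtype.ext (smul_zero _)
  smul_add _ _ _ := Subtype.ext (smul_add _ _ _)
  add_smul s t m := Subtype.ext (add_smul (MulOpposite.op (s.unop : Λ))
    (MulOpposite.op (t.unop : Λ)) (m : M.carrier))
  zero_smul m := Subtype.ext (zero_smul Λᵐᵒᵖ (m : M.carrier))

theorem surj_zero {X Y : GrMod 𝒜} (g : X ⟶ Y) (hg : Surj g) (y : Y.grade 0) :
    ∃ x : X.grade 0, degreeZeroMap g x = y := by
  obtain ⟨x, hx⟩ := hg y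
  refine ⟨⟨X.component 0 x, X.component_mem 0 x⟩, Subtype.ext ?_⟩
  change lin g (X.component 0 x) = y
  rw [lin_component, hx, component_same _ _ _ y.2]

theorem cover_projective [IsSemisimpleRing (𝒜 0)] (M : GrMod 𝒜) : IsProjective M.cover := by
  intro X Y g f hg
  let _ := modZero M
  let _ := modZero X
  let _ := modZero Y
  let gg : X.grade 0 →ₗ[(𝒜 0)ᵐᵒᵖ] Y.grade 0 :=
    { toFun := degreeZeroMap g
      map_add' := map_add _
      map_smul' := fun s m => Subtype.ext ((lin g).map_smul _ _) }
  let ff : M.grade 0 →ₗ[(𝒜 0)ᵐᵒᵖ] Y.grade 0 :=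
    { toFun := fun m => degreeZeroMap f (M.coverUnit m)
      map_add' := by intro x y; simp
      map_smul' := fun s m => by
        change degreeZeroMap f (M.coverUnit (M.degreeZeroSMul s.unop m)) = Y.degreeZeroSMul s.unop _
        rw [coverUnit_smul]
        exact Subtype.ext ((lin f).map_smul _ _) }
  have : Module.Projective (𝒜 0)ᵐᵒᵖ (M.grade 0) := Module.projective_of_isSemisimpleRing _ _
  obtain ⟨h, hh⟩ := Module.projective_lifting_property gg ff (surj_zero g hg)
  refine ⟨coverDesc h.toAddMonoidHom (fun s m => h.map_smul (MulOpposite.op s) m),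
    cover_hom_ext fun m a => ?_⟩
  rw [lin_comp]
  refine (congrArg (lin g) (coverDesc_tmk _ _ m a)).trans ?_
  rw [map_smul]
  have := congrArg Subtype.val (LinearMap.congr_fun hh m)
  change lin g (h m : X.carrier) = lin f (M.coverTmk m 1) at this
  change MulOpposite.op a • lin g (h m : X.carrier) = _
  rw [this, ← map_smul]
  change lin f (MulOpposite.op a • M.tmk m 1) = _
  rw [smul_tmk, one_mul]; rfl

theorem coverπ_surj (M : GrMod 𝒜) (h : M.GeneratedIn 0) : Surj M.coverπ := by
  unfold Surj
  rw [← LinearMap.range_eq_top, eq_top_iff, ← h, Submodule.span_le]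
  intro m hm
  exact ⟨M.coverTmk ⟨m, hm⟩ 1, by rw [coverπ_tmk]; simp⟩

theorem zero_unit (M : GrMod 𝒜) (x : M.cover.grade 0) : ∃ m, M.coverUnit m = x := by
  obtain ⟨x, hx⟩ := x
  have : ∀ x ∈ M.tensorGrade 0, ∃ m, M.tmk m 1 = x := by
    intro x hx
    induction hx using AddSubgroup.closure_induction with
    | mem x hx =>
      obtain ⟨i, a, m, hi, ha, rfl⟩ := hx
      obtain rfl : i = 0 := by simpa using hi
      refine ⟨M.degreeZeroSMul ⟨a, ha⟩ m, ?_⟩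
      have := congrArg Subtype.val (coverUnit_smul M ⟨a, ha⟩ m)
      refine (this.trans ?_ : M.tmk _ 1 = _)
      change MulOpposite.op a • M.tmk m 1 = _
      rw [smul_tmk, one_mul]
    | zero => exact ⟨0, by simp [tmk]⟩
    | add x y _ _ hx hy =>
      obtain ⟨m, rfl⟩ := hx
      obtain ⟨n, rfl⟩ := hy
      exact ⟨m + n, by simp only [tmk, TensorProduct.tmul_add, map_add]⟩
    | neg x _ hx =>
      obtain ⟨m, rfl⟩ := hx
      exact ⟨-m, by simp only [tmk, TensorProduct.tmul_neg, map_neg]⟩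
  obtain ⟨m, hm⟩ := this x hx
  exact ⟨m, Subtype.ext hm⟩

/-- A morphism into `M₀ ⊗_S Λ` is surjective if its composite with `M₀ ⊗_S Λ ⟶ M` is. -/
theorem coverπ_essential (M : GrMod 𝒜) (X : GrMod 𝒜) (g : X ⟶ M.cover)
    (hg : Surj (g ≫ M.coverπ)) : Surj g := by
  have key : ∀ m a, M.coverTmk m a ∈ LinearMap.range (lin g) := by
    intro m a
    obtain ⟨x, hx⟩ := surj_zero _ hg m
    obtain ⟨m', hm'⟩ := zero_unit M (degreeZeroMap g x)
    have h1 : m' = m := by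
      rw [← hx]
      refine Subtype.ext ?_
      change (m' : M.carrier) = lin M.coverπ (degreeZeroMap g x)
      rw [← hm']
      change _ = lin M.coverπ (M.coverTmk m' 1)
      rw [coverπ_tmk]; simp
    subst h1
    refine ⟨MulOpposite.op a • x, ?_⟩
    rw [map_smul]
    have h2 := congrArg Subtype.val hm'
    change M.tmk m' 1 = lin g x at h2
    rw [← h2]
    change MulOpposite.op a • M.tmk m' 1 = M.tmk m' a
    rw [smul_tmk, one_mul]
  intro y
  exact tensor_induction (p := fun y : Tensor M => y ∈ LinearMap.range (lin g)) (zero_mem _) key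
    (fun x y hx hy => add_mem hx hy) y

/-- The syzygy `ΩM`: the kernel of `M₀ ⊗_S Λ ⟶ M` (the syzygy of every `M` generated in
degree `0`). -/
def syzygy (M : GrMod 𝒜) : GrMod 𝒜 := ker M.coverπ

/-- The functor `F = Ω(-)(1)`. On a morphism `f` it is the restriction to the syzygies of the lift
of `f` to the covers. -/
def F : GrMod 𝒜 ⥤ GrMod 𝒜 where
  obj M := M.syzygy.shift 1
  map {M N} f := Hom.mk ((lin (coverMap f)).restrict (p := LinearMap.ker (lin M.coverπ))
      (q := LinearMap.ker (lin N.coverπ)) (by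
        intro x hx
        rw [LinearMap.mem_ker] at hx ⊢
        rw [← lin_comp, coverπ_naturality, lin_comp, hx, map_zero])) (by
    intro n x hx
    exact lin_mem (coverMap f) hx)
  map_id M := hom_ext fun x => Subtype.ext (congrArg (fun h => lin h x.1) (coverMap_id M))
  map_comp f g := hom_ext fun x => Subtype.ext (congrArg (fun h => lin h x.1) (coverMap_comp f g))

variable (𝒜) in
/-- The iterates `F^i`. -/
def Fpow : ℕ → (GrMod 𝒜 ⥤ GrMod 𝒜)
  | 0 => 𝟭 _
  | i + 1 => Fpow i ⋙ F

end

end GrMod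

/-! ### Ext rings -/

section Ext

variable {C : Type*} [Category C] [Abelian C] [HasExt.{u} C]

theorem ext_mk_eq {X Y Z : C} {a b c c' : ℕ} (α : Abelian.Ext X Y a) (β : Abelian.Ext Y Z b)
    (h : a + b = c) (h' : a + b = c') :
    (⟨c, α.comp β h⟩ : Σ n, Abelian.Ext X Z n) = ⟨c', α.comp β h'⟩ := by
  subst h; subst h'; rfl

/-- The Yoneda product. The product `f * g` is "`f` after `g`", that is, endomorphisms act from the
left. -/
instance extGMul (M : C) : GradedMonoid.GMul (fun n : ℕ => Abelian.Ext.{u} M M n) where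
  mul {i j} f g := g.comp f (Nat.add_comm j i)

instance extGOne (M : C) : GradedMonoid.GOne (fun n : ℕ => Abelian.Ext.{u} M M n) where
  one := Abelian.Ext.mk₀ (𝟙 M)

instance extGMonoid (M : C) : GradedMonoid.GMonoid (fun n : ℕ => Abelian.Ext.{u} M M n) where
  one_mul := by
    rintro ⟨n, a⟩
    refine (ext_mk_eq (c' := n) a (Abelian.Ext.mk₀ (𝟙 M)) _ (add_zero n)).trans ?_
    rw [Abelian.Ext.comp_mk₀_id]
  mul_one := by
    rintro ⟨n, a⟩
    refine (ext_mk_eq (c' := n) (Abelian.Ext.mk₀ (𝟙 M)) a _ (zero_add n)).trans ?_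
    rw [Abelian.Ext.mk₀_id_comp]
  mul_assoc := by
    rintro ⟨i, a⟩ ⟨j, b⟩ ⟨k, c⟩
    refine (ext_mk_eq (c' := i + (j + k)) c (b.comp a (Nat.add_comm j i)) _ (by lia)).trans ?_
    refine congrArg (Sigma.mk (i + (j + k))) ?_
    exact (Abelian.Ext.comp_assoc c b a (Nat.add_comm k j) (Nat.add_comm j i) (by lia)).symm

instance extGRing (M : C) : DirectSum.GRing (fun n : ℕ => Abelian.Ext.{u} M M n) where
  __ := extGMonoid M
  mul_zero _ := Abelian.Ext.zero_comp _ _ _ _ _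
  zero_mul _ := Abelian.Ext.comp_zero _ _ _ _ _
  mul_add _ _ _ := Abelian.Ext.add_comp _ _ _ _
  add_mul _ _ _ := Abelian.Ext.comp_add _ _ _ _
  natCast n := n • Abelian.Ext.mk₀ (𝟙 M)
  natCast_zero := zero_smul _ _
  natCast_succ n := succ_nsmul _ n
  intCast n := n • Abelian.Ext.mk₀ (𝟙 M)
  intCast_ofNat n := natCast_zsmul _ n
  intCast_negSucc_ofNat n := negSucc_zsmul _ n

/-- The Ext ring `Ext^•(M, M) = ⨁ n, Ext^n(M, M)`, a ring under the Yoneda product. -/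
abbrev ExtRing (M : C) : Type u := DirectSum ℕ fun n => Abelian.Ext.{u} M M n

/-- The element of degree `0` of `Ext^•(M, M)` given by an endomorphism of `M`. -/
def ofEnd {M : C} (f : M ⟶ M) : ExtRing M :=
  DirectSum.of (fun n : ℕ => Abelian.Ext.{u} M M n) 0 (Abelian.Ext.mk₀ f)

end Ext

/-! ### Piecewise domains and prime rings -/

/-- `R` is a piecewise domain with respect to the complete family `e` of pairwise orthogonal
idempotents. The condition `e i * x * e j = x` says that `x ∈ e i R e j`. -/
def IsPiecewiseDomain {R : Type*} [Ring R] {r : ℕ} (e : Fin r → R) : Prop :=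
  CompleteOrthogonalIdempotents e ∧
    ∀ (i j l : Fin r) (x y : R), e i * x * e j = x → e j * y * e l = y → x * y = 0 → x = 0 ∨ y = 0

/-- Prime rings. -/
def IsPrimeRing (R : Type*) [Ring R] : Prop :=
  Nontrivial R ∧ ∀ a b : R, (∀ x, a * x * b = 0) → a = 0 ∨ b = 0

/-! ### The modules of the theorem -/

section

variable {Λ : Type u} [Ring Λ] {𝒜 : ℕ → AddSubgroup Λ} {r : ℕ}

/-- The right `Λ`-module `S 0 ⊕ ⋯ ⊕ S (r - 1)`. -/
def directSum (S : Fin r → GrMod 𝒜) : ModuleCat.{u} Λᵐᵒᵖ :=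
  ModuleCat.of Λᵐᵒᵖ (DirectSum (Fin r) fun i => (S i).carrier)

/-- The idempotent of `Ext^•(M, M)`, where `M = ⨁ S i`, given by the projection of `M` onto its
summand `S i`. -/
def idem (S : Fin r → GrMod 𝒜) (i : Fin r) : ExtRing (directSum S) :=
  ofEnd (ModuleCat.ofHom
    (DirectSum.lof Λᵐᵒᵖ (Fin r) (fun i => (S i).carrier) i ∘ₗ
      DirectSum.component Λᵐᵒᵖ (Fin r) (fun i => (S i).carrier) i))

variable [GradedRing 𝒜]

/-- For all `i ≥ 0` and every nonzero `f : F^i(S l) ⟶ S m`, all `F^j(f)` with `j ≥ 0` are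
surjective. -/
def PreservesSurjections (S : Fin r → GrMod 𝒜) : Prop :=
  ∀ (i : ℕ) (l m : Fin r) (f : (GrMod.Fpow 𝒜 i).obj (S l) ⟶ S m), GrMod.Nonzero f →
    ∀ j : ℕ, GrMod.Surj ((GrMod.Fpow 𝒜 j).map f)

/-- For all `i ≥ 0`, every nonzero `f : F^i(S l) ⟶ S m` has a Koszul kernel. -/
def HasKoszulKernels (S : Fin r → GrMod 𝒜) : Prop :=
  ∀ (i : ℕ) (l m : Fin r) (f : (GrMod.Fpow 𝒜 i).obj (S l) ⟶ S m), GrMod.Nonzero f →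
    (GrMod.ker f).IsKoszul

/-- Every simple graded quotient of a module `F^j(S m)` is isomorphic to one of the `S p`. -/
def ContainsSimpleQuotients (S : Fin r → GrMod 𝒜) : Prop :=
  ∀ (j : ℕ) (m : Fin r) (T : GrMod 𝒜) (g : (GrMod.Fpow 𝒜 j).obj (S m) ⟶ T),
    IsSimpleModule Λᵐᵒᵖ T.carrier → GrMod.Surj g → ∃ p, Nonempty (T ≅ S p)

end

end KoszulExt

end

/-! Two mechanisms carry the proof. Since `Λ₀` is semisimple, a short exact sequence `0 → K → N → T
→ 0` splits in degree `0`, so the covers `M₀ ⊗ Λ` again form a short exact sequence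
(`IsShortExact.cover`). If `N` is generated in degree `0`, the snake lemma says that `K` is
generated in degree `0` exactly when `N → T` induces a surjection under `F`, and then `F` keeps the
sequence exact. Iterating (`IsShortExact.linearSyzygies_iff`), all `F^j(K)` are generated in degree
`0` if and only if all `F^j(f)` are surjective. Being Koszul means that all `F^j` are generated in
degree `0` (`isKoszul_iff_linearSyzygies`), so for `K = ker f` this is the equivalence of (b) and
(c).

The second mechanism computes Ext. Splicing the syzygy sequences of a Koszul module `M` gives a
class in `Ext^n(M, F^n M)`. If `T` is concentrated in degree `0`, every map from a cover to `T`
vanishes on the syzygy, and dimension shifting identifies `Hom(F^n M, T)` with `Ext^n(M, T)`. By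
naturality of the class, the Yoneda product of the classes of `f` and `g` is the class of `F^j(f) ≫
g` (`comp_eq_zero_iff`). Comparing components of lowest degree reduces (a) to homogeneous elements:
(a) says that `F^j(f) ≫ g` is nonzero for all nonzero `f` and `g` (`extNoZeroDivisors_iff`).

So (b) implies (a) because a surjection followed by a nonzero map is nonzero. Conversely, a
nonsurjective `F^j(f)` is annihilated by a map onto a simple graded module
(`exists_simple_quotient`), which by supposition is some `S p`; this contradicts (a). Primeness is
formal: in a piecewise domain all of whose corners `e i R e j` are nonzero, nonzero corners of `a`
and `b` can be linked by a nonzero element. -/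

noncomputable section

namespace KoszulExt

namespace GrMod

variable {Λ : Type u} [Ring Λ] {𝒜 : ℕ → AddSubgroup Λ}

/-! ### Graded modules, short exact sequences and components of degree `0`. -/

theorem induction_homogeneous (M : GrMod 𝒜) {p : M.carrier → Prop} (h0 : p 0)
    (hadd : ∀ x y, p x → p y → p (x + y)) (hom : ∀ n, ∀ x ∈ M.grade n, p x) (x : M.carrier) :
    p x := by
  obtain ⟨s, hs⟩ := M.exists_sum_component x
  rw [← hs]
  exact Finset.sum_induction _ p hadd h0 fun n _ => hom n _ (M.component_mem n x)

/-- The inclusion of the kernel of a morphism. -/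
def kerι {M N : GrMod 𝒜} (f : M ⟶ N) : ker f ⟶ M :=
  Hom.mk (LinearMap.ker (lin f)).subtype fun _ _ h => h

/-- Short exact sequences `0 ⟶ K ⟶ N ⟶ T ⟶ 0` of graded modules. -/
structure IsShortExact {K N T : GrMod 𝒜} (i : K ⟶ N) (f : N ⟶ T) : Prop where
  injective : Function.Injective (lin i)
  exact : ∀ x, lin f x = 0 ↔ ∃ k, lin i k = x
  surj : Surj f

theorem isShortExact_ker {M N : GrMod 𝒜} (f : M ⟶ N) (hf : Surj f) :
    IsShortExact (kerι f) f where
  injective := Subtype.val_injective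
  exact x := ⟨fun h => ⟨⟨x, h⟩, rfl⟩, by rintro ⟨k, rfl⟩; exact k.2⟩
  surj := hf

/-- The module is concentrated in degree `0`. -/
def Concentrated (M : GrMod 𝒜) : Prop := M.grade 0 = ⊤

theorem Concentrated.eq_zero {M : GrMod 𝒜} (h : M.Concentrated) {n : ℤ} (hn : n ≠ 0)
    {x : M.carrier} (hx : x ∈ M.grade n) : x = 0 := by
  have hx0 : x ∈ M.grade 0 := by rw [h]; trivial
  rw [← M.component_same 0 x hx0, M.component_ne n 0 x hn hx]

theorem Concentrated.smul_eq_zero {M : GrMod 𝒜} (h : M.Concentrated) {i : ℕ} (hi : i ≠ 0)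
    {a : Λ} (ha : a ∈ 𝒜 i) (x : M.carrier) : MulOpposite.op a • x = 0 := by
  have hx0 : x ∈ M.grade 0 := by rw [h]; trivial
  exact h.eq_zero (n := 0 + i) (by simpa using hi) (M.smul_mem ha hx0)

theorem surj_of_nonzero {M N : GrMod 𝒜} (hN : IsSimpleModule Λᵐᵒᵖ N.carrier) {f : M ⟶ N}
    (hf : Nonzero f) : Surj f :=
  LinearMap.surjective_of_ne_zero hf

theorem generatedIn_of_surj {M N : GrMod 𝒜} {n : ℤ} (f : M ⟶ N) (hf : Surj f)
    (hM : M.GeneratedIn n) : N.GeneratedIn n := by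
  unfold GeneratedIn at *
  rw [eq_top_iff, ← LinearMap.range_eq_top.2 hf, LinearMap.range_eq_map, ← hM, Submodule.map_span]
  refine Submodule.span_mono ?_
  rintro _ ⟨x, hx, rfl⟩
  exact lin_mem f hx

section

variable [GradedRing 𝒜]

theorem generatedIn_of_coverπ_surj (M : GrMod 𝒜) (h : Surj M.coverπ) : M.GeneratedIn 0 := by
  unfold GeneratedIn
  rw [eq_top_iff]
  intro x _
  obtain ⟨t, rfl⟩ := h x
  refine tensor_induction (p := fun t : Tensor M => lin M.coverπ t ∈
    Submodule.span Λᵐᵒᵖ (M.grade 0 : Set M.carrier)) ?_ ?_ ?_ t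
  · exact (map_zero (lin M.coverπ)).symm ▸ zero_mem _
  · intro m a
    have := M.coverπ_tmk m a
    change lin M.coverπ (M.coverTmk m a) ∈ _
    rw [this]
    exact Submodule.smul_mem _ _ (Submodule.subset_span m.2)
  · intro x y hx hy
    exact ((lin M.coverπ).map_add x y).symm ▸ add_mem hx hy

theorem cover_grade_neg (M : GrMod 𝒜) {n : ℤ} (hn : n < 0) {x : M.cover.carrier}
    (hx : x ∈ M.cover.grade n) : x = 0 := by
  change x ∈ M.tensorGrade n at hx
  have : {t | ∃ (i : ℕ) (a : Λ) (m : M.grade 0), (i : ℤ) = n ∧ a ∈ 𝒜 i ∧ t = M.tmk m a} = ∅ := by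
    ext t
    simp only [Set.mem_ofPred_eq, Set.mem_empty_iff_false, iff_false]
    rintro ⟨i, a, m, h, -⟩
    lia
  rw [tensorGrade, this, AddSubgroup.closure_empty] at hx
  exact hx

theorem GeneratedIn.grade_neg {M : GrMod 𝒜} (hM : M.GeneratedIn 0) {n : ℤ} (hn : n < 0)
    {x : M.carrier} (hx : x ∈ M.grade n) : x = 0 := by
  obtain ⟨t, rfl⟩ := M.coverπ_surj hM x
  rw [← M.component_same n _ hx, ← lin_component,
    cover_grade_neg M hn (M.cover.component_mem n t), map_zero]

/-- Nothing lives in negative degrees of `M`, so only the degree `0` parts of `a` and `x`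
contribute. This is what makes `zeroComap` a `Λ`-submodule. -/
theorem GeneratedIn.component_zero_smul {M : GrMod 𝒜} (hM : M.GeneratedIn 0) (a : Λ)
    (x : M.carrier) : M.component 0 (MulOpposite.op a • x) =
      MulOpposite.op (DirectSum.decompose 𝒜 a 0 : Λ) • M.component 0 x := by
  classical
  induction x using M.induction_homogeneous with
  | h0 => simp
  | hadd x y hx hy => rw [smul_add, map_add, hx, hy, map_add, smul_add]
  | hom n x hx =>
    rcases lt_or_ge n 0 with hn | hn
    · rw [hM.grade_neg hn hx]; simp
    induction a using DirectSum.Decomposition.inductionOn 𝒜 with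
    | zero => simp
    | add a b ha hb =>
      rw [MulOpposite.op_add, add_smul, map_add, ha, hb, DirectSum.decompose_add,
        DirectSum.add_apply, AddSubgroup.coe_add, MulOpposite.op_add, add_smul]
    | @homogeneous i a =>
      have h := M.smul_mem a.2 hx
      by_cases hi : i = 0
      · subst hi
        rw [DirectSum.decompose_of_mem_same 𝒜 a.2]
        by_cases hn0 : n = 0
        · subst hn0
          rw [M.component_same 0 x hx, M.component_same 0 _ (by simpa using h)]
        · rw [M.component_ne n 0 x hn0 hx, M.component_ne _ 0 _ (by simpa using hn0) h, smul_zero]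
      · rw [DirectSum.decompose_of_mem_ne 𝒜 a.2 hi, M.component_ne _ 0 _ (by lia) h]
        simp

/-- The submodule of elements whose component of degree `0` lies in a given submodule of `M₀`. -/
def zeroComap (M : GrMod 𝒜) (hM : M.GeneratedIn 0)
    (W : @Submodule (𝒜 0)ᵐᵒᵖ (M.grade 0) _ _ (modZero M)) : Submodule Λᵐᵒᵖ M.carrier where
  carrier := {x | (⟨M.component 0 x, M.component_mem 0 x⟩ : M.grade 0) ∈ W}
  zero_mem' := by
    have : (⟨M.component 0 0, M.component_mem 0 0⟩ : M.grade 0) = 0 := Subtype.ext (map_zero _)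
    rw [Set.mem_ofPred_eq, this]
    exact zero_mem _
  add_mem' {x y} hx hy := by
    have : (⟨M.component 0 (x + y), M.component_mem 0 _⟩ : M.grade 0) =
      ⟨M.component 0 x, M.component_mem 0 x⟩ + ⟨M.component 0 y, M.component_mem 0 y⟩ :=
      Subtype.ext (map_add _ _ _)
    rw [Set.mem_ofPred_eq, this]
    exact add_mem hx hy
  smul_mem' a x hx := by
    let _ := modZero M
    have : (⟨M.component 0 (a • x), M.component_mem 0 _⟩ : M.grade 0) =
      MulOpposite.op (DirectSum.decompose 𝒜 a.unop 0) • ⟨M.component 0 x, M.component_mem 0 x⟩ :=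
      Subtype.ext (hM.component_zero_smul a.unop x)
    rw [Set.mem_ofPred_eq, this]
    exact W.smul_mem _ hx

theorem mem_zeroComap {M : GrMod 𝒜} {hM : M.GeneratedIn 0} {W} {x : M.carrier} :
    x ∈ M.zeroComap hM W ↔ (⟨M.component 0 x, M.component_mem 0 x⟩ : M.grade 0) ∈ W := Iff.rfl

theorem mem_zeroComap_of_mem {M : GrMod 𝒜} {hM : M.GeneratedIn 0} {W} {x : M.carrier}
    (hx : x ∈ M.grade 0) : x ∈ M.zeroComap hM W ↔ (⟨x, hx⟩ : M.grade 0) ∈ W := by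
  have : (⟨M.component 0 x, M.component_mem 0 x⟩ : M.grade 0) = ⟨x, hx⟩ :=
    Subtype.ext (M.component_same 0 x hx)
  rw [mem_zeroComap, this]

theorem sub_component_mem_zeroComap {M : GrMod 𝒜} {hM : M.GeneratedIn 0} {W} (x : M.carrier) :
    x - M.component 0 x ∈ M.zeroComap hM W := by
  have : (⟨M.component 0 (x - M.component 0 x), M.component_mem 0 _⟩ : M.grade 0) = 0 :=
    Subtype.ext (by
      change M.component 0 (x - M.component 0 x) = 0
      rw [map_sub, M.component_same 0 _ (M.component_mem 0 x), sub_self])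
  rw [mem_zeroComap, this]
  exact zero_mem _

/-- The elements without component of degree `0` form a submodule. By simplicity it is zero, which
is the claim, or everything; in the latter case `M₀ = 0`, although `M₀` generates the nonzero module
`M`. -/
theorem concentrated_of_isSimpleModule {M : GrMod 𝒜} (hM : M.GeneratedIn 0)
    (hs : IsSimpleModule Λᵐᵒᵖ M.carrier) : M.Concentrated := by
  let _ := modZero M
  rcases eq_bot_or_eq_top (M.zeroComap hM ⊥) with h | h
  · refine eq_top_iff.2 fun x _ => ?_
    have := sub_component_mem_zeroComap (hM := hM) (W := ⊥) x
    rw [h, Submodule.mem_bot, sub_eq_zero] at this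
    rw [this]
    exact M.component_mem 0 x
  · exfalso
    have hb : (M.grade 0 : Set M.carrier) ⊆ {0} := by
      intro x hx
      have hx' : x ∈ M.zeroComap hM ⊥ := by rw [h]; trivial
      rw [mem_zeroComap_of_mem hx, Submodule.mem_bot] at hx'
      exact congrArg Subtype.val hx'
    have := IsSimpleModule.nontrivial Λᵐᵒᵖ M.carrier
    unfold GeneratedIn at hM
    have hb' : Submodule.span Λᵐᵒᵖ (M.grade 0 : Set M.carrier) ≤ ⊥ := Submodule.span_le.2 hb
    rw [hM] at hb'
    exact bot_ne_top (top_le_iff.1 hb')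

/-! ### Covers and short exact sequences -/

/-- The morphism `M₀ ⊗ Λ ⟶ N₀ ⊗ Λ` induced by a `Λ₀`-linear map `M₀ → N₀`. -/
def coverMapZero {M N : GrMod 𝒜}
    (r : letI := modZero M; letI := modZero N; M.grade 0 →ₗ[(𝒜 0)ᵐᵒᵖ] N.grade 0) :
    M.cover ⟶ N.cover :=
  letI := modZero M
  letI := modZero N
  coverDesc (N.coverUnit.comp r.toAddMonoidHom) (by
    intro s m
    refine Eq.trans ?_ (coverUnit_smul N s (r m))
    exact congrArg N.coverUnit (r.map_smul (MulOpposite.op s) m))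

theorem coverMapZero_tmk {M N : GrMod 𝒜}
    (r : letI := modZero M; letI := modZero N; M.grade 0 →ₗ[(𝒜 0)ᵐᵒᵖ] N.grade 0)
    (m : M.grade 0) (a : Λ) : lin (coverMapZero r) (M.coverTmk m a) = N.coverTmk (r m) a := by
  refine (coverDesc_tmk _ _ _ _).trans
    (show MulOpposite.op a • N.tmk (r m) 1 = N.tmk (r m) a from ?_)
  rw [smul_tmk, one_mul]

/-- The restriction of a morphism to the components of degree `0`, as a `Λ₀`-linear map. -/
def zeroLin {M N : GrMod 𝒜} (f : M ⟶ N) :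
    letI := modZero M; letI := modZero N; M.grade 0 →ₗ[(𝒜 0)ᵐᵒᵖ] N.grade 0 :=
  letI := modZero M
  letI := modZero N
  { degreeZeroMap f with
    map_smul' := fun _ _ => Subtype.ext ((lin f).map_smul _ _) }

theorem zeroLin_apply {M N : GrMod 𝒜} (f : M ⟶ N) (m : M.grade 0) :
    zeroLin f m = degreeZeroMap f m := rfl

theorem coverTmk_add (M : GrMod 𝒜) (m m' : M.grade 0) (a : Λ) :
    M.coverTmk (m + m') a = M.coverTmk m a + M.coverTmk m' a := by
  change M.tmk (m + m') a = M.tmk m a + M.tmk m' a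
  simp only [tmk, TensorProduct.tmul_add, map_add]

theorem coverTmk_zero (M : GrMod 𝒜) (a : Λ) : M.coverTmk 0 a = 0 := by
  change M.tmk 0 a = 0
  simp only [tmk, TensorProduct.tmul_zero, map_zero]

/-- The sequence of degree `0` parts splits over the semisimple ring `Λ₀`, and tensoring carries the
splitting identities to the covers. -/
theorem IsShortExact.cover [IsSemisimpleRing (𝒜 0)] {K N T : GrMod 𝒜} {i : K ⟶ N} {f : N ⟶ T}
    (h : IsShortExact i f) : IsShortExact (coverMap i) (coverMap f) := by
  let _ := modZero K
  let _ := modZero N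
  let _ := modZero T
  have : Module.Projective (𝒜 0)ᵐᵒᵖ (T.grade 0) := Module.projective_of_isSemisimpleRing _ _
  obtain ⟨s, hs⟩ := Module.projective_lifting_property (zeroLin f) LinearMap.id
    (surj_zero f h.surj)
  have hi : Function.Injective (zeroLin i) := fun x y hxy =>
    Subtype.ext (h.injective (congrArg Subtype.val hxy))
  have hex : ∀ x, zeroLin f x = 0 → ∃ k, zeroLin i k = x := by
    intro x hx
    obtain ⟨k, hk⟩ := (h.exact x).1 (congrArg Subtype.val hx)
    refine ⟨⟨K.component 0 k, K.component_mem 0 k⟩, Subtype.ext ?_⟩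
    change lin i (K.component 0 k) = x
    rw [lin_component, hk, N.component_same 0 _ x.2]
  obtain ⟨r, hr⟩ := IsSemisimpleModule.extension_property (zeroLin i) hi LinearMap.id
  have hfi : ∀ k, zeroLin f (zeroLin i k) = 0 := fun k =>
    Subtype.ext ((h.exact _).2 ⟨k, rfl⟩)
  have hri : ∀ k, r (zeroLin i k) = k := fun k => LinearMap.congr_fun hr k
  have hfs : ∀ t, zeroLin f (s t) = t := fun t => LinearMap.congr_fun hs t
  -- The retraction `r` need not vanish on the image of the section `s`; this correction gives the
  -- decomposition `i r' + s f = id`.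
  let r' : N.grade 0 →ₗ[(𝒜 0)ᵐᵒᵖ] K.grade 0 := r ∘ₗ (LinearMap.id - s ∘ₗ zeroLin f)
  have hr' : ∀ x, zeroLin i (r' x) + s (zeroLin f x) = x := by
    intro x
    obtain ⟨k, hk⟩ := hex (x - s (zeroLin f x)) (by rw [map_sub, hfs, sub_self])
    have : r' x = k := by
      change r (x - s (zeroLin f x)) = k
      rw [← hk, hri]
    rw [this, hk, sub_add_cancel]
  have e1 : coverMap i ≫ coverMapZero r = 𝟙 _ := cover_hom_ext fun m a => by
    rw [lin_comp, coverMap_tmk, coverMapZero_tmk, ← zeroLin_apply, hri, lin_id]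
  have e2 : coverMapZero s ≫ coverMap f = 𝟙 _ := cover_hom_ext fun m a => by
    rw [lin_comp, coverMapZero_tmk, coverMap_tmk, ← zeroLin_apply, hfs, lin_id]
  have e3 : ∀ k, lin (coverMap f) (lin (coverMap i) k) = 0 := by
    intro k
    refine tensor_induction (p := fun k : Tensor K =>
      lin (coverMap f) (lin (coverMap i) k) = 0) ?_ ?_ ?_ k
    · exact (congrArg _ (map_zero (lin (coverMap i)))).trans (map_zero _)
    · intro m a
      change lin (coverMap f) (lin (coverMap i) (K.coverTmk m a)) = 0
      rw [coverMap_tmk, coverMap_tmk, ← zeroLin_apply, ← zeroLin_apply, hfi, coverTmk_zero]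
    · intro x y hx hy
      refine (congrArg _ ((lin (coverMap i)).map_add x y)).trans ?_
      rw [map_add, hx, hy, add_zero]
  have e4 : ∀ x, lin (coverMap i) (lin (coverMapZero r') x) +
      lin (coverMapZero s) (lin (coverMap f) x) = x := by
    intro x
    refine tensor_induction (p := fun x : Tensor N => lin (coverMap i) (lin (coverMapZero r') x) +
      lin (coverMapZero s) (lin (coverMap f) x) = x) ?_ ?_ ?_ x
    · have a1 := map_zero (lin (coverMapZero r'))
      have a2 := map_zero (lin (coverMap f))
      refine (congrArg₂ (fun a b => lin (coverMap i) a + lin (coverMapZero s) b) a1 a2).trans ?_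
      rw [map_zero, map_zero, add_zero]; rfl
    · intro m a
      change lin (coverMap i) (lin (coverMapZero r') (N.coverTmk m a)) +
        lin (coverMapZero s) (lin (coverMap f) (N.coverTmk m a)) = N.coverTmk m a
      rw [coverMapZero_tmk, coverMap_tmk, coverMap_tmk, coverMapZero_tmk, ← coverTmk_add,
        ← zeroLin_apply, ← zeroLin_apply, hr']
    · intro x y hx hy
      have a1 := (lin (coverMapZero r')).map_add x y
      have a2 := (lin (coverMap f)).map_add x y
      refine (congrArg₂ (fun a b => lin (coverMap i) a + lin (coverMapZero s) b) a1 a2).trans ?_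
      rw [map_add, map_add, add_add_add_comm, hx, hy]
      rfl
  refine ⟨?_, fun x => ⟨fun hx => ⟨lin (coverMapZero r') x, ?_⟩, ?_⟩, ?_⟩
  · intro x y hxy
    rw [← lin_id K.cover x, ← lin_id K.cover y, ← e1, lin_comp, lin_comp, hxy]
  · have := e4 x
    rwa [hx, map_zero, add_zero] at this
  · rintro ⟨k, rfl⟩
    exact e3 k
  · intro y
    exact ⟨lin (coverMapZero s) y, by rw [← lin_comp, e2, lin_id]⟩

theorem lin_coverπ_coverMap {M N : GrMod 𝒜} (f : M ⟶ N) (x : M.cover.carrier) :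
    lin N.coverπ (lin (coverMap f) x) = lin f (lin M.coverπ x) := by
  rw [← lin_comp, coverπ_naturality, lin_comp]

/-- Snake lemma for the covers over the sequence: as `N.coverπ` is surjective, the cokernel of
`F.map f` is that of `K.coverπ`, which is zero exactly when `K` is generated in degree `0`. -/
theorem IsShortExact.generatedIn_iff [IsSemisimpleRing (𝒜 0)] {K N T : GrMod 𝒜} {i : K ⟶ N}
    {f : N ⟶ T} (h : IsShortExact i f) (hN : N.GeneratedIn 0) :
    K.GeneratedIn 0 ↔ Surj (F.map f) := by
  have hc := h.cover
  constructor
  · rintro hK ⟨y, hy⟩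
    obtain ⟨n, rfl⟩ := hc.surj y
    rw [LinearMap.mem_ker, lin_coverπ_coverMap] at hy
    obtain ⟨k, hk⟩ := (h.exact _).1 hy
    obtain ⟨c, rfl⟩ := K.coverπ_surj hK k
    refine ⟨⟨n - lin (coverMap i) c, ?_⟩, Subtype.ext ?_⟩
    · rw [LinearMap.mem_ker, map_sub, lin_coverπ_coverMap, hk, sub_self]
    · change lin (coverMap f) (n - lin (coverMap i) c) = lin (coverMap f) n
      rw [map_sub, (hc.exact _).2 ⟨c, rfl⟩, sub_zero]
  · intro hF
    refine K.generatedIn_of_coverπ_surj fun k => ?_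
    obtain ⟨n, hn⟩ := N.coverπ_surj hN (lin i k)
    obtain ⟨⟨w, hw⟩, hwn⟩ := hF ⟨lin (coverMap f) n, by
      rw [LinearMap.mem_ker, lin_coverπ_coverMap, hn]
      exact (h.exact _).2 ⟨k, rfl⟩⟩
    have hwn' : lin (coverMap f) w = lin (coverMap f) n := congrArg Subtype.val hwn
    obtain ⟨c, hc⟩ := (hc.exact (n - w)).1 (by rw [map_sub, hwn', sub_self])
    refine ⟨c, h.injective ?_⟩
    rw [← lin_coverπ_coverMap, hc, map_sub, hn, LinearMap.mem_ker.1 hw, sub_zero]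

/-- Injectivity and exactness in the middle are inherited from the covers; only surjectivity can
fail. -/
theorem IsShortExact.F_map [IsSemisimpleRing (𝒜 0)] {K N T : GrMod 𝒜} {i : K ⟶ N}
    {f : N ⟶ T} (h : IsShortExact i f) (hF : Surj (F.map f)) :
    IsShortExact (F.map i) (F.map f) := by
  have hc := h.cover
  refine ⟨fun x y hxy => Subtype.ext (hc.injective (congrArg Subtype.val hxy)),
    fun x => ⟨fun hx => ?_, ?_⟩, hF⟩
  · obtain ⟨c, hcx⟩ := (hc.exact x.1).1 (congrArg Subtype.val hx)
    refine ⟨⟨c, h.injective ?_⟩, Subtype.ext hcx⟩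
    rw [← lin_coverπ_coverMap, hcx, map_zero]
    exact x.2
  · rintro ⟨k, rfl⟩
    exact Subtype.ext ((hc.exact _).2 ⟨k.1, rfl⟩)

/-- All iterated syzygies are generated in degree `0` after the shifts. -/
def LinearSyzygies (M : GrMod 𝒜) : Prop := ∀ n, ((Fpow 𝒜 n).obj M).GeneratedIn 0

/-- Generation of `F^j(K)` in degree `0` amounts to surjectivity of `F^(j+1)(f)`, one step later,
and this keeps the sequence exact for the next step of the induction. -/
theorem IsShortExact.linearSyzygies_iff [IsSemisimpleRing (𝒜 0)] {K N T : GrMod 𝒜} {i : K ⟶ N}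
    {f : N ⟶ T} (h : IsShortExact i f) (hN : N.LinearSyzygies) :
    K.LinearSyzygies ↔ ∀ j, Surj ((Fpow 𝒜 j).map f) := by
  constructor
  · intro hK
    have : ∀ j, IsShortExact ((Fpow 𝒜 j).map i) ((Fpow 𝒜 j).map f) := by
      intro j
      induction j with
      | zero => exact h
      | succ j ih => exact ih.F_map ((ih.generatedIn_iff (hN j)).1 (hK j))
    exact fun j => (this j).surj
  · intro hs
    have : ∀ j, IsShortExact ((Fpow 𝒜 j).map i) ((Fpow 𝒜 j).map f) := by
      intro j
      induction j with
      | zero => exact h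
      | succ j ih => exact ih.F_map (hs (j + 1))
    exact fun j => ((this j).generatedIn_iff (hN j)).2 (hs (j + 1))

end


/-! ### Linear resolutions, and Koszul modules as modules with linear syzygies. -/

/-- The shift of a morphism. -/
def shiftMap {M N : GrMod 𝒜} (k : ℤ) (f : M ⟶ N) : M.shift k ⟶ N.shift k :=
  Hom.mk (lin (M := M) (N := N) f) fun _ _ h => lin_mem (M := M) (N := N) f h

/-- A morphism into a shift, as a morphism from the opposite shift. -/
def unshift {M N : GrMod 𝒜} (k : ℤ) (f : M ⟶ N.shift k) : M.shift (-k) ⟶ N :=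
  Hom.mk (lin (M := M) (N := N.shift k) f) fun n x h => by
    have := lin_mem (M := M) (N := N.shift k) f (n := n + -k) h
    change lin f x ∈ N.grade (n + -k + k) at this
    rwa [neg_add_cancel_right] at this

/-- A morphism from a shift, as a morphism into the opposite shift. -/
def toShift {M N : GrMod 𝒜} (k : ℤ) (f : M.shift (-k) ⟶ N) : M ⟶ N.shift k :=
  Hom.mk (lin (M := M.shift (-k)) (N := N) f) fun n x h => by
    refine lin_mem (M := M.shift (-k)) (N := N) f (n := n + k) ?_
    change x ∈ M.grade (n + k + -k)
    rwa [add_neg_cancel_right]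

theorem surj_shiftMap {M N : GrMod 𝒜} {k : ℤ} {f : M ⟶ N} : Surj (shiftMap k f) ↔ Surj f :=
  ⟨fun h y => h y, fun h y => h y⟩

theorem surj_unshift {M N : GrMod 𝒜} {k : ℤ} {f : M ⟶ N.shift k} : Surj (unshift k f) ↔ Surj f :=
  ⟨fun h y => h y, fun h y => h y⟩

theorem IsProjective.shift {P : GrMod 𝒜} (hP : P.IsProjective) (k : ℤ) :
    (P.shift k).IsProjective := by
  intro X Y g f hg
  obtain ⟨k, rfl⟩ : ∃ l, k = -l := ⟨-k, by simp⟩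
  obtain ⟨h, hh⟩ := hP (X.shift k) (Y.shift k) (shiftMap k g) (toShift k f) (surj_shiftMap.2 hg)
  exact ⟨unshift k h, hom_ext fun (x : P.carrier) =>
    congrArg (fun h : P ⟶ Y.shift k => lin h x) hh⟩

theorem generatedIn_shift {M : GrMod 𝒜} {n k : ℤ} :
    (M.shift k).GeneratedIn n ↔ M.GeneratedIn (n + k) := Iff.rfl

/-- Shifts of essential epimorphisms are essential. -/
theorem essential_shift {P N : GrMod 𝒜} {p : P ⟶ N}
    (hp : ∀ (X : GrMod 𝒜) (g : X ⟶ P), Surj (g ≫ p) → Surj g) (k : ℤ) (X : GrMod 𝒜)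
    (g : X ⟶ P.shift k) (hg : Surj (g ≫ shiftMap k p)) : Surj g :=
  surj_unshift.1 (hp _ (unshift k g) fun y => hg y)

section

variable [GradedRing 𝒜]

theorem cover_generatedIn (M : GrMod 𝒜) : M.cover.GeneratedIn 0 := by
  unfold GeneratedIn
  rw [eq_top_iff]
  intro x _
  refine tensor_induction (p := fun t : Tensor M => (t : M.cover.carrier) ∈
    Submodule.span Λᵐᵒᵖ (M.cover.grade 0 : Set M.cover.carrier)) (zero_mem _) ?_
      (fun x y hx hy => add_mem hx hy) x
  intro m a
  have : M.coverTmk m a = MulOpposite.op a • M.coverTmk m 1 := by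
    change M.tmk m a = MulOpposite.op a • M.tmk m 1
    rw [smul_tmk, one_mul]
  change M.coverTmk m a ∈ Submodule.span Λᵐᵒᵖ (M.cover.grade 0 : Set M.cover.carrier)
  rw [this]
  exact Submodule.smul_mem _ _ (Submodule.subset_span (M.coverUnit m).2)

/-- The terms of the linear resolution of a module with linear syzygies. -/
def linearTerm (M : GrMod 𝒜) (n : ℕ) : GrMod 𝒜 := ((Fpow 𝒜 n).obj M).cover.shift (-n)

/-- The covering of the `n`th syzygy. -/
def linearCover (M : GrMod 𝒜) (n : ℕ) : M.linearTerm n ⟶ ((Fpow 𝒜 n).obj M).shift (-n) :=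
  shiftMap (-n) ((Fpow 𝒜 n).obj M).coverπ

/-- The inclusion of the `n + 1`st syzygy in the `n`th term. -/
def linearIncl (M : GrMod 𝒜) (n : ℕ) :
    ((Fpow 𝒜 (n + 1)).obj M).shift (-(n + 1 : ℕ)) ⟶ M.linearTerm n :=
  Hom.mk (LinearMap.ker (lin ((Fpow 𝒜 n).obj M).coverπ)).subtype fun k x h => by
    change x.1 ∈ ((Fpow 𝒜 n).obj M).cover.grade (k + -((n + 1 : ℕ) : ℤ) + 1) at h
    change x.1 ∈ ((Fpow 𝒜 n).obj M).cover.grade (k + -(n : ℤ))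
    -- The shift by `1` built into `F` compensates for passing from `-n` to `-(n + 1)`.
    have e : k + -((n + 1 : ℕ) : ℤ) + 1 = k + -(n : ℤ) := by push_cast; ring
    rwa [e] at h

/-- The augmentation of the linear resolution. -/
def linearAug (M : GrMod 𝒜) : M.linearTerm 0 ⟶ M :=
  Hom.mk (lin (M := M.cover) M.coverπ) fun n (x : M.cover.carrier) h => by
    have h : x ∈ M.cover.grade (n + -((0 : ℕ) : ℤ)) := h
    rw [Nat.cast_zero, neg_zero, add_zero] at h
    exact lin_mem M.coverπ h

/-- The differentials of the linear resolution. -/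
def linearD (M : GrMod 𝒜) (n : ℕ) : M.linearTerm (n + 1) ⟶ M.linearTerm n :=
  M.linearCover (n + 1) ≫ M.linearIncl n

theorem linearD_eq_zero (M : GrMod 𝒜) (n : ℕ) (x : ((Fpow 𝒜 (n + 1)).obj M).cover.carrier) :
    lin (M.linearD n) x = 0 ↔ lin ((Fpow 𝒜 (n + 1)).obj M).coverπ x = 0 :=
  ⟨fun h => Subtype.ext h, fun h => congrArg Subtype.val h⟩

theorem exists_linearD_eq {M : GrMod 𝒜} (h : M.LinearSyzygies) (n : ℕ)
    (x : ((Fpow 𝒜 n).obj M).cover.carrier) :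
    (∃ y, lin (M.linearD n) y = x) ↔ lin ((Fpow 𝒜 n).obj M).coverπ x = 0 := by
  constructor
  · rintro ⟨y, rfl⟩
    exact (lin ((Fpow 𝒜 (n + 1)).obj M).coverπ y).2
  · intro hx
    obtain ⟨y, hy⟩ := ((Fpow 𝒜 (n + 1)).obj M).coverπ_surj (h (n + 1)) ⟨x, hx⟩
    exact ⟨y, congrArg Subtype.val hy⟩

/-- The covers of the successive syzygies are spliced; minimality is `coverπ_essential`. -/
theorem LinearSyzygies.isKoszul [IsSemisimpleRing (𝒜 0)] {M : GrMod 𝒜} (h : M.LinearSyzygies) :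
    M.IsKoszul := by
  refine ⟨h 0, M.linearTerm, M.linearD, M.linearAug,
    ⟨fun n => (cover_projective _).shift _, fun y => M.coverπ_surj (h 0) y, ?_, ?_, ?_, ?_⟩, ?_⟩
  · ext x
    exact exists_linearD_eq h 0 x
  · intro n
    ext x
    exact (exists_linearD_eq h (n + 1) x).trans (linearD_eq_zero M n x).symm
  · intro X g hg
    exact essential_shift (coverπ_essential M) (-(0 : ℕ)) X g fun y => hg y
  · intro n X g hg
    refine essential_shift (coverπ_essential _) (-(n + 1 : ℕ)) X g fun y => ?_
    have hy : y.1 ∈ LinearMap.range (lin (M.linearD n)) := (exists_linearD_eq h n y.1).2 y.2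
    rw [← hg] at hy
    obtain ⟨x, hx⟩ := hy
    exact ⟨x, Subtype.ext hx⟩
  · intro n
    refine generatedIn_shift.2 ?_
    rw [add_neg_cancel]
    exact cover_generatedIn _

/-- By minimality `P 0` is isomorphic to the standard cover, so the rest of the resolution, shifted
by `1`, is a minimal resolution of `F M`. -/
theorem IsKoszul.F_obj [IsSemisimpleRing (𝒜 0)] {M : GrMod 𝒜} (h : M.IsKoszul) :
    (F.obj M).IsKoszul := by
  obtain ⟨hM, P, d, ε, hP, hgen⟩ := h
  obtain ⟨s, hs⟩ := cover_projective M (P 0) M ε M.coverπ hP.surj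
  obtain ⟨t, ht⟩ := hP.projective 0 M.cover M M.coverπ ε (M.coverπ_surj hM)
  have hs_surj : Surj s := hP.minimal_zero _ s (by rw [hs]; exact M.coverπ_surj hM)
  -- An endomorphism of the cover over `M` is the identity, because `coverπ` is injective in degree
  -- `0` and the cover is generated there.
  have hst : s ≫ t = 𝟙 _ := by
    have e : (s ≫ t) ≫ M.coverπ = M.coverπ := by rw [Category.assoc, ht, hs]
    refine cover_hom_ext fun m a => ?_
    obtain ⟨m', hm'⟩ := M.zero_unit (degreeZeroMap (s ≫ t) (M.coverUnit m))
    have h1 : M.coverTmk m' 1 = lin (s ≫ t) (M.coverTmk m 1) := congrArg Subtype.val hm'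
    have h2 : m' = m := by
      have := congrArg (lin M.coverπ) h1
      rw [← lin_comp, e, coverπ_tmk, coverπ_tmk] at this
      exact Subtype.ext (by simpa using this)
    have h3 : M.coverTmk m a = MulOpposite.op a • M.coverTmk m 1 := by
      change M.tmk m a = MulOpposite.op a • M.tmk m 1
      rw [smul_tmk, one_mul]
    rw [h3, map_smul, ← h1, h2, lin_id]
  have hts : ∀ x, lin s (lin t x) = x := by
    intro x
    obtain ⟨y, rfl⟩ := hs_surj x
    have : lin t (lin s y) = y := congrArg (fun h => lin h y) hst
    rw [this]
  have hε : ∀ x, lin ε (lin s x) = lin M.coverπ x := fun x => congrArg (fun h => lin h x) hs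
  have hπ : ∀ x, lin M.coverπ (lin t x) = lin ε x := fun x => congrArg (fun h => lin h x) ht
  have hd : ∀ x, lin ε (lin (d 0) x) = 0 := fun x => by
    have : lin (d 0) x ∈ LinearMap.ker (lin ε) := hP.exact_zero ▸ ⟨x, rfl⟩
    exact this
  let ε' : (P 1).shift 1 ⟶ F.obj M :=
    Hom.mk ((lin (M := P 1) (d 0 ≫ t)).codRestrict (LinearMap.ker (lin M.coverπ)) fun x => by
      rw [LinearMap.mem_ker, lin_comp, hπ, hd]) fun n x hx =>
        lin_mem (M := P 1) (d 0 ≫ t) (n := n + 1) hx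
  have hε' : ∀ x : (P 1).carrier, (lin ε' x).1 = lin t (lin (d 0) x) := fun _ => rfl
  have hsε' : ∀ x : (P 1).carrier, lin s (lin ε' x).1 = lin (d 0) x := fun x =>
    (congrArg (lin s) (hε' x)).trans (hts _)
  have hε'surj : Surj ε' := by
    rintro ⟨y, hy⟩
    have : lin s y ∈ LinearMap.range (lin (d 0)) := by
      rw [hP.exact_zero, LinearMap.mem_ker, hε]; exact hy
    obtain ⟨x, hx⟩ := this
    refine ⟨x, Subtype.ext ((hε' x).trans ?_)⟩
    rw [hx]
    exact congrArg (fun h => lin h y) hst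
  have hker : ∀ x : (P 1).carrier, lin ε' x = 0 ↔ lin (d 0) x = 0 := by
    intro x
    constructor
    · intro hx
      rw [← hsε', hx]
      exact map_zero _
    · intro hx
      refine Subtype.ext ((hε' x).trans ?_)
      rw [hx, map_zero]
      rfl
  have hexact : ∀ n (x : (P (n + 1)).carrier),
      (∃ y, lin (d (n + 1)) y = x) ↔ lin (d n) x = 0 := fun n x => by
    rw [← LinearMap.mem_ker, ← hP.exact_succ n, LinearMap.mem_range]
  refine ⟨generatedIn_of_surj ε' hε'surj ?_, fun n => (P (n + 1)).shift 1,
    fun n => shiftMap 1 (d (n + 1)), ε', ⟨fun n => (hP.projective _).shift _, hε'surj, ?_,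
      ?_, ?_, ?_⟩, ?_⟩
  · exact generatedIn_shift.2 (hgen 1)
  · ext x
    exact (hexact 0 x).trans (hker x).symm
  · intro n
    ext x
    exact hexact (n + 1) x
  · intro X g hg
    -- Since `s` composed with `ε'` is `d 0`, surjectivity of `g ≫ ε'` says that `g` does not shrink
    -- the range of `d 0`.
    refine surj_unshift.1 (hP.minimal_succ 0 _ (unshift 1 g) (le_antisymm ?_ ?_))
    · rintro _ ⟨x, rfl⟩
      exact ⟨_, rfl⟩
    · rintro _ ⟨x, rfl⟩
      obtain ⟨y, hy⟩ := hg (lin ε' x)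
      exact ⟨y, (hsε' _).symm.trans ((congrArg (fun z => lin s z.1) hy).trans (hsε' x))⟩
  · intro n X g hg
    refine surj_unshift.1 (hP.minimal_succ (n + 1) _ (unshift 1 g) ?_)
    ext x
    exact SetLike.ext_iff.1 hg x
  · intro n
    exact generatedIn_shift.2 (by exact_mod_cast hgen (n + 1))

theorem isKoszul_iff_linearSyzygies [IsSemisimpleRing (𝒜 0)] {M : GrMod 𝒜} :
    M.IsKoszul ↔ M.LinearSyzygies := by
  refine ⟨fun h n => ?_, LinearSyzygies.isKoszul⟩
  have : ∀ n, ((Fpow 𝒜 n).obj M).IsKoszul := by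
    intro n
    induction n with
    | zero => exact h
    | succ n ih => exact ih.F_obj
  exact (this n).1

theorem LinearSyzygies.Fpow_obj {M : GrMod 𝒜} (h : M.LinearSyzygies) (i : ℕ) :
    ((Fpow 𝒜 i).obj M).LinearSyzygies := by
  intro n
  have : ∀ n, (Fpow 𝒜 n).obj ((Fpow 𝒜 i).obj M) = (Fpow 𝒜 (i + n)).obj M := by
    intro n
    induction n with
    | zero => rfl
    | succ n ih => exact congrArg F.obj ih
  rw [this]
  exact h _

end

end GrMod

/-! ### Equivalence of (b) and (c). -/

theorem preservesSurjections_iff {Λ : Type u} [Ring Λ] {𝒜 : ℕ → AddSubgroup Λ} [GradedRing 𝒜]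
    [IsSemisimpleRing (𝒜 0)] {r : ℕ} (S : Fin r → GrMod 𝒜)
    (hsimple : ∀ l, IsSimpleModule Λᵐᵒᵖ (S l).carrier) (hKoszul : ∀ l, (S l).IsKoszul) :
    PreservesSurjections S ↔ HasKoszulKernels S := by
  have key : ∀ (i : ℕ) (l m : Fin r) (f : (GrMod.Fpow 𝒜 i).obj (S l) ⟶ S m), GrMod.Nonzero f →
      ((GrMod.ker f).IsKoszul ↔ ∀ j : ℕ, GrMod.Surj ((GrMod.Fpow 𝒜 j).map f)) := by
    intro i l m f hf
    rw [GrMod.isKoszul_iff_linearSyzygies]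
    exact (GrMod.isShortExact_ker f (GrMod.surj_of_nonzero (hsimple m) hf)).linearSyzygies_iff
      ((GrMod.isKoszul_iff_linearSyzygies.1 (hKoszul l)).Fpow_obj i)
  exact ⟨fun h i l m f hf => (key i l m f hf).2 (h i l m f hf),
    fun h i l m f hf => (key i l m f hf).1 (h i l m f hf)⟩

/-! ### Ext groups of Koszul modules through syzygies. -/

namespace GrMod

variable {Λ : Type u} [Ring Λ] {𝒜 : ℕ → AddSubgroup Λ}

/-- The underlying ungraded module. -/
def toMod (M : GrMod 𝒜) : ModuleCat.{u} Λᵐᵒᵖ := ModuleCat.of Λᵐᵒᵖ M.carrier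

/-- The underlying linear map of a morphism, in the category of modules. -/
def modMap {M N : GrMod 𝒜} (f : M ⟶ N) : M.toMod ⟶ N.toMod := ModuleCat.ofHom (lin f)

theorem modMap_comp {M N P : GrMod 𝒜} (f : M ⟶ N) (g : N ⟶ P) :
    modMap (f ≫ g) = modMap f ≫ modMap g := rfl

section

variable [GradedRing 𝒜]

/-- Ext is computed among all modules, so projectivity is needed against ungraded maps as well. A
linear map out of `M₀ ⊗ Λ` is a `Λ₀`-linear map out of `M₀`, which is projective. -/
instance projective_cover [IsSemisimpleRing (𝒜 0)] (M : GrMod 𝒜) : Projective M.cover.toMod where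
  factors {E X} f e he := by
    let φ : 𝒜 0 →+* Λ := (SetLike.GradeZero.subring 𝒜).subtype
    let _ := modZero M
    let _ : Module (𝒜 0)ᵐᵒᵖ E := Module.compHom E φ.op
    let _ : Module (𝒜 0)ᵐᵒᵖ X := Module.compHom X φ.op
    let ee : E →ₗ[(𝒜 0)ᵐᵒᵖ] X :=
      { e.hom.toAddMonoidHom with map_smul' := fun s x => e.hom.map_smul _ x }
    let ff : M.grade 0 →ₗ[(𝒜 0)ᵐᵒᵖ] X :=
      { toFun := fun m => f.hom (M.coverTmk m 1)
        map_add' := fun x y => by rw [coverTmk_add]; exact f.hom.map_add _ _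
        map_smul' := fun s m => by
          have := congrArg Subtype.val (coverUnit_smul M s.unop m)
          exact (congrArg f.hom this).trans (f.hom.map_smul _ _) }
    have : Module.Projective (𝒜 0)ᵐᵒᵖ (M.grade 0) := Module.projective_of_isSemisimpleRing _ _
    obtain ⟨h, hh⟩ := Module.projective_lifting_property ee ff
      ((ModuleCat.epi_iff_surjective e).1 he)
    refine ⟨ModuleCat.ofHom (M.tensorDesc h.toAddMonoidHom
      (fun s m => h.map_smul (MulOpposite.op s) m)), ?_⟩
    ext x
    refine tensor_induction (p := fun x : Tensor M => e.hom (M.tensorDesc h.toAddMonoidHom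
      (fun s m => h.map_smul (MulOpposite.op s) m) x) = f.hom x) ?_ ?_ ?_ x
    · rw [map_zero, map_zero]
      exact (map_zero f.hom).symm
    · intro m a
      refine (congrArg e.hom (M.tensorDesc_tmk h.toAddMonoidHom _ m a)).trans ?_
      rw [map_smul]
      have h1 : e.hom (h m) = f.hom (M.coverTmk m 1) := LinearMap.congr_fun hh m
      have h2 : M.coverTmk m a = MulOpposite.op a • M.coverTmk m 1 := by
        change M.tmk m a = MulOpposite.op a • M.tmk m 1
        rw [smul_tmk, one_mul]
      change MulOpposite.op a • e.hom (h m) = f.hom (M.coverTmk m a)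
      rw [h1, h2]
      exact (f.hom.map_smul _ _).symm
    · intro x y hx hy
      rw [map_add, map_add, hx, hy]
      exact (f.hom.map_add _ _).symm

/-- The short complex `F(M) ⟶ M₀ ⊗ Λ ⟶ M` of ungraded modules. -/
abbrev syzygyComplex (M : GrMod 𝒜) : ShortComplex (ModuleCat.{u} Λᵐᵒᵖ) :=
  ShortComplex.mk (X₁ := (F.obj M).toMod) (X₂ := M.cover.toMod) (X₃ := M.toMod)
    (ModuleCat.ofHom (LinearMap.ker (lin M.coverπ)).subtype) (modMap M.coverπ)
    (by ext x; exact x.2)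

theorem syzygyComplex_shortExact {M : GrMod 𝒜} (hM : M.GeneratedIn 0) :
    M.syzygyComplex.ShortExact :=
  LinearMap.shortExact_shortComplexKer (M.coverπ_surj hM)

/-- The morphism of short complexes induced by a morphism of graded modules. -/
def syzygyComplexMap {M N : GrMod 𝒜} (f : M ⟶ N) : M.syzygyComplex ⟶ N.syzygyComplex where
  τ₁ := modMap (F.map f)
  τ₂ := modMap (coverMap f)
  τ₃ := modMap f
  comm₁₂ := by ext x; rfl
  comm₂₃ := congrArg modMap (coverπ_naturality f)

open Abelian

/-- The class in `Ext^1(M, F(M))` of the syzygy sequence. -/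
def syzygyExt {M : GrMod 𝒜} (hM : M.GeneratedIn 0) : Ext.{u} M.toMod (F.obj M).toMod 1 :=
  (syzygyComplex_shortExact hM).extClass

theorem syzygyExt_naturality {M N : GrMod 𝒜} (hM : M.GeneratedIn 0) (hN : N.GeneratedIn 0)
    (f : M ⟶ N) : (syzygyExt hM).comp (Ext.mk₀ (modMap (F.map f))) (add_zero 1) =
      (Ext.mk₀ (modMap f)).comp (syzygyExt hN) (zero_add 1) :=
  ShortComplex.ShortExact.extClass_naturality (syzygyComplex_shortExact hM)
    (syzygyComplex_shortExact hN) (syzygyComplexMap f)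

/-- The class in `Ext^n(M, F^n(M))` of the linear resolution of a module with linear syzygies. -/
def syzygyClass {M : GrMod 𝒜} (h : M.LinearSyzygies) :
    ∀ n, Ext.{u} M.toMod ((Fpow 𝒜 n).obj M).toMod n
  | 0 => Ext.mk₀ (𝟙 _)
  | n + 1 => (syzygyClass h n).comp (syzygyExt (h n)) rfl

theorem syzygyClass_zero_comp {M : GrMod 𝒜} (h : M.LinearSyzygies) {T : ModuleCat.{u} Λᵐᵒᵖ}
    {j : ℕ} (y : Ext.{u} ((Fpow 𝒜 0).obj M).toMod T j) :
    (syzygyClass h 0).comp y (zero_add j) = y :=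
  Ext.mk₀_id_comp y

theorem syzygyClass_succ_comp {M : GrMod 𝒜} (h : M.LinearSyzygies) {T : ModuleCat.{u} Λᵐᵒᵖ}
    {i j n : ℕ} (hn : i + 1 + j = n) (y : Ext.{u} (F.obj ((Fpow 𝒜 i).obj M)).toMod T j) :
    (syzygyClass h (i + 1)).comp y hn =
      (syzygyClass h i).comp ((syzygyExt (h i)).comp y (add_comm 1 j)) (by lia) :=
  Ext.comp_assoc (syzygyClass h i) (syzygyExt (h i)) y rfl (add_comm 1 j) (by lia)

theorem comp_syzygyClass_succ {M : GrMod 𝒜} (h : M.LinearSyzygies) {T : ModuleCat.{u} Λᵐᵒᵖ}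
    {n : ℕ} (y : Ext.{u} T M.toMod 0) :
    y.comp (syzygyClass h (n + 1)) (zero_add (n + 1)) =
      (y.comp (syzygyClass h n) (zero_add n)).comp (syzygyExt (h n)) rfl :=
  (Ext.comp_assoc y (syzygyClass h n) (syzygyExt (h n)) (zero_add n) rfl (by lia)).symm

/-- This moves a morphism past the class, at the price of applying `F^n` to it. -/
theorem syzygyClass_naturality {M N : GrMod 𝒜} (hM : M.LinearSyzygies) (hN : N.LinearSyzygies)
    (f : M ⟶ N) (n : ℕ) :
    (syzygyClass hM n).comp (Ext.mk₀ (modMap ((Fpow 𝒜 n).map f))) (add_zero n) =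
      (Ext.mk₀ (modMap f)).comp (syzygyClass hN n) (zero_add n) := by
  induction n with
  | zero =>
    exact (syzygyClass_zero_comp hM _).trans (Ext.comp_mk₀_id (Ext.mk₀ (modMap f))).symm
  | succ n ih =>
    rw [comp_syzygyClass_succ, ← ih, Ext.comp_assoc_of_second_deg_zero,
      ← syzygyExt_naturality (hM n)]
    exact syzygyClass_succ_comp hM _ _

/-- The part of the cover in a degree `n ≠ 0` is spanned by elements `(m ⊗ 1) a` with `a` of
positive degree, and such `a` annihilate `T`. The map `φ` is not assumed to be graded. -/
theorem cover_map_eq {M T : GrMod 𝒜} (hT : T.Concentrated)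
    (φ : M.cover.carrier →ₗ[Λᵐᵒᵖ] T.carrier) (x : M.cover.carrier) :
    φ x = φ (M.cover.component 0 x) := by
  classical
  induction x using M.cover.induction_homogeneous with
  | h0 => simp
  | hadd x y hx hy => rw [map_add, map_add, map_add, hx, hy]
  | hom n x hx =>
    by_cases hn : n = 0
    · subst hn
      rw [component_same _ _ _ hx]
    · rw [component_ne _ _ _ _ hn hx, map_zero]
      change x ∈ M.tensorGrade n at hx
      suffices H : ∀ x ∈ M.tensorGrade n, φ (x : M.cover.carrier) = 0 from H x hx
      intro x hx
      induction hx using AddSubgroup.closure_induction with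
      | mem x hx =>
        obtain ⟨i, a, m, rfl, ha, rfl⟩ := hx
        have h2 : M.coverTmk m a = MulOpposite.op a • M.coverTmk m 1 := by
          change M.tmk m a = MulOpposite.op a • M.tmk m 1
          rw [smul_tmk, one_mul]
        change φ (M.coverTmk m a) = 0
        rw [h2, map_smul]
        exact hT.smul_eq_zero (by simpa using hn) ha _
      | zero => exact map_zero φ
      | add x y _ _ hx hy => exact (φ.map_add x y).trans (by rw [hx, hy, add_zero])
      | neg x _ hx => exact (φ.map_neg x).trans (by rw [hx, neg_zero])

/-- As `coverπ` is injective in degree `0`, an element of the syzygy has no component there. -/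
theorem cover_map_syzygy {M T : GrMod 𝒜} (hT : T.Concentrated)
    (φ : M.cover.carrier →ₗ[Λᵐᵒᵖ] T.carrier) {x : M.cover.carrier} (hx : lin M.coverπ x = 0) :
    φ x = 0 := by
  rw [cover_map_eq hT]
  have h : lin M.coverπ (M.cover.component 0 x) = 0 := by rw [lin_component, hx, map_zero]
  obtain ⟨m, hm⟩ := M.zero_unit ⟨M.cover.component 0 x, M.cover.component_mem 0 x⟩
  have hm' : M.coverTmk m 1 = M.cover.component 0 x := congrArg Subtype.val hm
  rw [← hm', coverπ_tmk, MulOpposite.op_one, one_smul] at h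
  have hm0 : m = 0 := Subtype.ext h
  rw [← hm', hm0, coverTmk_zero, map_zero]

/-- By the long exact sequence `y` comes from `Ext^n` of the cover. That group is zero for `n > 0`;
for `n = 0` its elements are maps that vanish on the syzygy. -/
theorem syzygyExt_comp_eq_zero [IsSemisimpleRing (𝒜 0)] {M T : GrMod 𝒜} (hM : M.GeneratedIn 0)
    (hT : T.Concentrated) {n n' : ℕ} (hn : 1 + n = n') (y : Ext.{u} (F.obj M).toMod T.toMod n)
    (hy : (syzygyExt hM).comp y hn = 0) : y = 0 := by
  obtain ⟨z, rfl⟩ := Ext.contravariant_sequence_exact₁ (syzygyComplex_shortExact hM) _ y hn hy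
  cases n with
  | zero =>
    obtain ⟨φ, rfl⟩ := Ext.mk₀_bijective _ _ |>.2 z
    rw [Ext.mk₀_comp_mk₀]
    refine (Ext.mk₀_eq_zero_iff _).2 ?_
    ext x
    exact cover_map_syzygy hT φ.hom x.2
  | succ n =>
    rw [Ext.eq_zero_of_projective z, Ext.comp_zero]

theorem syzygyClass_comp_eq_zero [IsSemisimpleRing (𝒜 0)] {M T : GrMod 𝒜} (hM : M.LinearSyzygies)
    (hT : T.Concentrated) {i j n : ℕ} (hn : i + j = n)
    (y : Ext.{u} ((Fpow 𝒜 i).obj M).toMod T.toMod j)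
    (hy : (syzygyClass hM i).comp y hn = 0) : y = 0 := by
  induction i generalizing j with
  | zero =>
    obtain rfl : j = n := by lia
    rwa [syzygyClass_zero_comp] at hy
  | succ i ih =>
    exact syzygyExt_comp_eq_zero (hM i) hT (add_comm 1 j) y
      (ih (by lia) _ ((syzygyClass_succ_comp hM hn y).symm.trans hy))

/-- Dimension shifting: the obstruction to factoring through the next syzygy lies in a positive Ext
group of a projective cover. -/
theorem exists_syzygyClass_comp [IsSemisimpleRing (𝒜 0)] {M T : GrMod 𝒜} (hM : M.LinearSyzygies)
    {i j n : ℕ} (hn : i + j = n) (x : Ext.{u} M.toMod T.toMod n) :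
    ∃ y, (syzygyClass hM i).comp y hn = x := by
  induction i generalizing j with
  | zero =>
    obtain rfl : j = n := by lia
    exact ⟨x, syzygyClass_zero_comp hM x⟩
  | succ i ih =>
    obtain ⟨y, hy⟩ := ih (j := j + 1) (by lia)
    obtain ⟨z, rfl⟩ := Ext.contravariant_sequence_exact₃ (syzygyComplex_shortExact (hM i)) _ y
      (Ext.eq_zero_of_projective _) (add_comm 1 j)
    exact ⟨z, (syzygyClass_succ_comp hM hn z).trans hy⟩

/-- A linear map from a module generated in degree `0` to a module concentrated in degree `0`
preserves degrees. -/
def homOfConcentrated {M T : GrMod 𝒜} (hM : M.GeneratedIn 0) (hT : T.Concentrated)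
    (φ : M.carrier →ₗ[Λᵐᵒᵖ] T.carrier) : M ⟶ T :=
  Hom.mk φ fun n x hx => by
    by_cases hn : n = 0
    · subst hn
      rw [hT]; trivial
    · obtain ⟨t, rfl⟩ := M.coverπ_surj hM x
      -- The component of `t` in degree `0` is sent to that of `x`, which is zero because `x` has
      -- degree `n ≠ 0`.
      have h := cover_map_eq hT (φ ∘ₗ lin M.coverπ) t
      rw [LinearMap.comp_apply, LinearMap.comp_apply, lin_component, component_ne _ _ _ _ hn hx,
        map_zero] at h
      rw [h]
      exact zero_mem _

/-- Dimension shifting yields an ungraded map `F^n(M) → T`, which automatically preserves degrees.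
Thus ungraded Ext is described by graded morphisms. -/
theorem exists_extClass_eq [IsSemisimpleRing (𝒜 0)] {M T : GrMod 𝒜} (hM : M.LinearSyzygies)
    (hT : T.Concentrated) {n : ℕ} (x : Ext.{u} M.toMod T.toMod n) :
    ∃ f : (Fpow 𝒜 n).obj M ⟶ T,
      (syzygyClass hM n).comp (Ext.mk₀ (modMap f)) (add_zero n) = x := by
  obtain ⟨y, hy⟩ := exists_syzygyClass_comp hM (add_zero n) x
  obtain ⟨φ, rfl⟩ := Ext.mk₀_bijective _ _ |>.2 y
  exact ⟨homOfConcentrated (hM n) hT φ.hom, hy⟩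

theorem syzygyClass_comp_eq_zero_iff [IsSemisimpleRing (𝒜 0)] {M T : GrMod 𝒜}
    (hM : M.LinearSyzygies) (hT : T.Concentrated) {n : ℕ} (f : (Fpow 𝒜 n).obj M ⟶ T) :
    (syzygyClass hM n).comp (Ext.mk₀ (modMap f)) (add_zero n) = 0 ↔ ¬ Nonzero f := by
  have h1 : modMap f = 0 ↔ lin f = 0 :=
    ⟨fun h => congrArg ModuleCat.Hom.hom h, fun h => ModuleCat.hom_ext h⟩
  rw [Nonzero, not_not, ← h1, ← Ext.mk₀_eq_zero_iff]
  refine ⟨syzygyClass_comp_eq_zero hM hT _ _, fun h => ?_⟩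
  rw [h, Ext.comp_zero]

/-- The Yoneda product of the classes of `f : F^i(M) ⟶ N` and `g : F^j(N) ⟶ T` vanishes if and
only if `F^j(f) ≫ g` does. -/
theorem comp_eq_zero_iff [IsSemisimpleRing (𝒜 0)] {M N T : GrMod 𝒜} (hM : M.LinearSyzygies)
    (hN : N.LinearSyzygies) (hT : T.Concentrated) {i j n : ℕ} (hn : i + j = n)
    (f : (Fpow 𝒜 i).obj M ⟶ N) (g : (Fpow 𝒜 j).obj N ⟶ T) :
    ((syzygyClass hM i).comp (Ext.mk₀ (modMap f)) (add_zero i)).comp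
      ((syzygyClass hN j).comp (Ext.mk₀ (modMap g)) (add_zero j)) hn = 0 ↔
      ¬ Nonzero ((Fpow 𝒜 j).map f ≫ g) := by
  have hMi := hM.Fpow_obj i
  -- Naturality moves `f` past the class of `N`, where it becomes `F^j(f)`.
  have h : ((syzygyClass hM i).comp (Ext.mk₀ (modMap f)) (add_zero i)).comp
      ((syzygyClass hN j).comp (Ext.mk₀ (modMap g)) (add_zero j)) hn =
      (syzygyClass hM i).comp ((syzygyClass hMi j).comp
        (Ext.mk₀ (modMap ((Fpow 𝒜 j).map f ≫ g))) (add_zero j)) hn := by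
    rw [Ext.comp_assoc_of_second_deg_zero,
      ← Ext.comp_assoc _ _ _ (zero_add j) (add_zero j) (by lia),
      ← syzygyClass_naturality hMi hN, Ext.comp_assoc_of_third_deg_zero, Ext.mk₀_comp_mk₀,
      modMap_comp]
  rw [h, ← syzygyClass_comp_eq_zero_iff hMi hT]
  refine ⟨syzygyClass_comp_eq_zero hM hT _ _, fun h => ?_⟩
  rw [h, Ext.comp_zero]

end

end GrMod

/-! ### Lowest components in graded rings; prime rings from piecewise domains. -/

theorem directSum_mul_apply_lowest {A : ℕ → Type*} [∀ i, AddCommGroup (A i)] [DirectSum.GSemiring A]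
    (x y : DirectSum ℕ A) {a b : ℕ} (hx : ∀ i < a, x i = 0) (hy : ∀ j < b, y j = 0) :
    (x * y) (a + b) = GradedMonoid.GMul.mul (x a) (y b) := by
  classical
  rw [DirectSum.mul_eq_sum_support_ghas_mul, DFinsupp.finsetSum_apply,
    Finset.sum_eq_single (a, b)]
  · exact DirectSum.of_eq_same _ _
  · rintro ⟨i, j⟩ hij hne
    simp only [Finset.mem_product, DFinsupp.mem_support_toFun] at hij
    refine DirectSum.of_eq_of_ne _ _ _ fun h => hne ?_
    have hi : a ≤ i := not_lt.1 fun h => hij.1 (hx i h)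
    have hj : b ≤ j := not_lt.1 fun h => hij.2 (hy j h)
    simp only at h
    rw [Prod.mk.injEq]
    lia
  · intro h
    simp only [Finset.mem_product, DFinsupp.mem_support_toFun, not_and_or, not_not] at h
    rcases h with h | h
    · rw [h, DirectSum.GNonUnitalNonAssocSemiring.zero_mul, map_zero]; rfl
    · rw [h, DirectSum.GNonUnitalNonAssocSemiring.mul_zero, map_zero]; rfl

theorem exists_lowest {A : ℕ → Type*} [∀ i, AddCommGroup (A i)] {x : DirectSum ℕ A} (hx : x ≠ 0) :
    ∃ a, x a ≠ 0 ∧ ∀ i < a, x i = 0 := by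
  classical
  have h : ∃ a, x a ≠ 0 := by
    by_contra! h
    exact hx (DFinsupp.ext h)
  exact ⟨Nat.find h, Nat.find_spec h, fun i hi => not_not.1 (Nat.find_min h hi)⟩

theorem isPrimeRing_of_isPiecewiseDomain {R : Type*} [Ring R] {r : ℕ} (hr : 1 ≤ r) {e : Fin r → R}
    (h : IsPiecewiseDomain e) (hu : ∀ i j, ∃ u, u ≠ 0 ∧ e i * u * e j = u) : IsPrimeRing R := by
  obtain ⟨u, hu0, -⟩ := hu ⟨0, hr⟩ ⟨0, hr⟩
  refine ⟨⟨u, 0, hu0⟩, fun a b hab => ?_⟩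
  by_contra! hne
  have corner : ∀ a : R, a ≠ 0 → ∃ i j, e i * a * e j ≠ 0 := by
    intro a ha
    by_contra! h0
    refine ha ?_
    rw [← one_mul a, ← mul_one (1 * a), ← h.1.complete, Finset.sum_mul, Finset.sum_mul]
    refine Finset.sum_eq_zero fun i _ => ?_
    rw [Finset.mul_sum]
    exact Finset.sum_eq_zero fun j _ => h0 i j
  have he : ∀ i x, e i * (e i * x) = e i * x := fun i x => by
    rw [← mul_assoc, (h.1.idem i).eq]
  obtain ⟨i, j, ha⟩ := corner a hne.1
  obtain ⟨k, l, hb⟩ := corner b hne.2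
  -- The element `v` links the two corners: the product of `e i * a * e j`, `v` and `e k * b * e l`
  -- is zero by `hab`, yet a product of nonzero composable corner elements.
  obtain ⟨v, hv, hv'⟩ := hu j k
  have c1 : e i * (e i * a * e j) * e j = e i * a * e j := by
    simp only [mul_assoc, he, (h.1.idem _).eq]
  have c2 : e k * (e k * b * e l) * e l = e k * b * e l := by
    simp only [mul_assoc, he, (h.1.idem _).eq]
  have c3 : e i * (e i * a * e j * v) * e k = e i * a * e j * v := by
    rw [← hv']
    simp only [mul_assoc, he, (h.1.idem _).eq]
  have c4 : e i * a * e j * v * (e k * b * e l) = 0 := by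
    have := congrArg (fun z => e i * z * e l) (hab (e j * v * e k))
    simpa only [mul_assoc, mul_zero, zero_mul] using this
  rcases h.2 i k l _ _ c3 c2 c4 with h1 | h1
  · rcases h.2 i j k _ _ c1 hv' h1 with h2 | h2
    · exact ha h2
    · exact hv h2
  · exact hb h1

/-! ### The Ext ring of a finite direct sum as a ring of matrices. -/

open Abelian

section

variable {C : Type*} [Category C] [Abelian C] [HasExt.{u} C]

/-- The bifunctoriality of `Ext`. -/
def extConj {X Y X' Y' : C} {n : ℕ} (f : X' ⟶ X) (x : Ext.{u} X Y n) (g : Y ⟶ Y') :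
    Ext.{u} X' Y' n :=
  ((Ext.mk₀ f).comp x (zero_add n)).comp (Ext.mk₀ g) (add_zero n)

theorem extConj_zero {X Y X' Y' : C} {n : ℕ} (f : X' ⟶ X) (g : Y ⟶ Y') :
    extConj f (0 : Ext.{u} X Y n) g = 0 := by
  rw [extConj, Ext.comp_zero, Ext.zero_comp]

theorem extConj_id {X Y : C} {n : ℕ} (x : Ext.{u} X Y n) : extConj (𝟙 X) x (𝟙 Y) = x := by
  rw [extConj, Ext.mk₀_id_comp, Ext.comp_mk₀_id]

theorem extConj_extConj {X Y X' Y' X'' Y'' : C} {n : ℕ} (f' : X'' ⟶ X') (f : X' ⟶ X)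
    (x : Ext.{u} X Y n) (g : Y ⟶ Y') (g' : Y' ⟶ Y'') :
    extConj f' (extConj f x g) g' = extConj (f' ≫ f) x (g ≫ g') := by
  unfold extConj
  rw [← Ext.mk₀_comp_mk₀, ← Ext.mk₀_comp_mk₀, Ext.comp_assoc_of_third_deg_zero,
    Ext.comp_assoc_of_third_deg_zero, Ext.comp_assoc_of_third_deg_zero, Ext.mk₀_comp_mk₀_assoc,
    Ext.mk₀_comp_mk₀, Ext.mk₀_comp_mk₀, Ext.comp_assoc_of_third_deg_zero]

theorem extConj_comp_extConj {X Y Z W X' Z' : C} {a b n : ℕ} (h : a + b = n) (f : X' ⟶ X)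
    (x : Ext.{u} X Y a) (g : Y ⟶ W) (g' : W ⟶ Y) (hg : g ≫ g' = 𝟙 Y) (y : Ext.{u} Y Z b)
    (k : Z ⟶ Z') : (extConj f x g).comp (extConj g' y k) h = extConj f (x.comp y h) k := by
  unfold extConj
  rw [Ext.comp_assoc_of_second_deg_zero, Ext.comp_assoc_of_third_deg_zero (Ext.mk₀ g'),
    Ext.mk₀_comp_mk₀_assoc, hg, Ext.mk₀_id_comp, Ext.comp_assoc_of_third_deg_zero,
    Ext.comp_assoc_of_third_deg_zero, Ext.comp_assoc _ _ _ (zero_add a) h (by lia)]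

theorem of_mul_of_ext {M : C} {i j n : ℕ} (x : Ext.{u} M M i) (y : Ext.{u} M M j) (h : j + i = n) :
    (DirectSum.of (fun n : ℕ => Ext.{u} M M n) i x * DirectSum.of _ j y : ExtRing M) =
      DirectSum.of _ n (y.comp x h) := by
  rw [DirectSum.of_mul_of]
  exact DirectSum.of_eq_of_gradedMonoid_eq (ext_mk_eq y x (Nat.add_comm j i) h)

theorem ofEnd_mul {M : C} (f g : M ⟶ M) : ofEnd.{u} f * ofEnd g = ofEnd (g ≫ f) := by
  unfold ofEnd
  rw [of_mul_of_ext _ _ (zero_add 0), Ext.mk₀_comp_mk₀]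

theorem ofEnd_mul_mul_ofEnd {M : C} (f g : M ⟶ M) (x : ExtRing.{u} M) (n : ℕ) :
    (ofEnd f * x * ofEnd g) n = extConj g (x n) f := by
  induction x using DirectSum.induction_on with
  | zero =>
    rw [mul_zero, zero_mul]
    exact (extConj_zero g f).symm
  | of m x =>
    have h : (ofEnd f * DirectSum.of _ m x * ofEnd g : ExtRing.{u} M) =
        DirectSum.of _ m (extConj g x f) := by
      unfold ofEnd
      rw [of_mul_of_ext _ _ (add_zero m), of_mul_of_ext _ _ (zero_add m), extConj,
        Ext.comp_assoc_of_third_deg_zero]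
    rw [h]
    by_cases hn : n = m
    · subst hn
      rw [DirectSum.of_eq_same, DirectSum.of_eq_same]
    · rw [DirectSum.of_eq_of_ne _ _ _ hn, DirectSum.of_eq_of_ne _ _ _ hn, extConj_zero]
  | add x y hx hy =>
    rw [mul_add, add_mul, DirectSum.add_apply, hx, hy, DirectSum.add_apply]
    simp only [extConj, Ext.comp_add, Ext.add_comp]

variable {r : ℕ} {X : Fin r → C} {M : C} {ι : ∀ i, X i ⟶ M} {p : ∀ i, M ⟶ X i}

theorem completeOrthogonalIdempotents_ofEnd (h1 : ∀ i, ι i ≫ p i = 𝟙 _)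
    (h2 : ∀ i j, i ≠ j → ι i ≫ p j = 0) (h3 : ∑ i, p i ≫ ι i = 𝟙 M) :
    CompleteOrthogonalIdempotents fun i => ofEnd.{u} (p i ≫ ι i) where
  idem i := by
    rw [IsIdempotentElem, ofEnd_mul, Category.assoc, reassoc_of% (h1 i)]
  ortho i j hij := by
    change ofEnd _ * ofEnd _ = 0
    rw [ofEnd_mul, Category.assoc, ← Category.assoc (ι j), h2 j i hij.symm, Limits.zero_comp,
      Limits.comp_zero, ofEnd, Ext.mk₀_zero, map_zero]
  complete := by
    unfold ofEnd
    rw [← map_sum, ← Ext.mk₀_sum, h3]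
    rfl

/-- The Yoneda product of nonzero elements of the groups `Ext^n(X i, X j)` is nonzero. -/
def ExtNoZeroDivisors (X : Fin r → C) : Prop :=
  ∀ (l m q : Fin r) (a b n : ℕ) (h : a + b = n) (x : Ext.{u} (X l) (X m) a)
    (y : Ext.{u} (X m) (X q) b), x.comp y h = 0 → x = 0 ∨ y = 0

/-- Left multiplication is postcomposition, so `Ext(X l, X m)` is the corner with `m` on the left
and `l` on the right. -/
theorem ofEnd_mul_of_mul_ofEnd (h1 : ∀ i, ι i ≫ p i = 𝟙 _) {l m : Fin r} {a : ℕ}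
    (x : Ext.{u} (X l) (X m) a) :
    (ofEnd (p m ≫ ι m) * DirectSum.of _ a (extConj (p l) x (ι m)) * ofEnd (p l ≫ ι l) :
      ExtRing.{u} M) = DirectSum.of _ a (extConj (p l) x (ι m)) := by
  refine DFinsupp.ext fun n => ?_
  refine (ofEnd_mul_mul_ofEnd _ _ _ n).trans ?_
  by_cases hn : n = a
  · subst hn
    rw [DirectSum.of_eq_same, extConj_extConj, Category.assoc, h1, Category.comp_id,
      reassoc_of% (h1 m)]
  · rw [DirectSum.of_eq_of_ne _ _ _ hn, extConj_zero]

theorem extConj_eq_zero_iff (h1 : ∀ i, ι i ≫ p i = 𝟙 _) {l m : Fin r} {a : ℕ}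
    (x : Ext.{u} (X l) (X m) a) : extConj (p l) x (ι m) = 0 ↔ x = 0 := by
  refine ⟨fun h => ?_, fun h => by rw [h, extConj_zero]⟩
  rw [← extConj_id x, ← h1, ← h1, ← extConj_extConj, h, extConj_zero]

/-- Corner elements may be inhomogeneous, but the product of their lowest components is a component
of their product, so homogeneous elements suffice. -/
theorem isPiecewiseDomain_ofEnd_iff (h1 : ∀ i, ι i ≫ p i = 𝟙 _)
    (h2 : ∀ i j, i ≠ j → ι i ≫ p j = 0) (h3 : ∑ i, p i ≫ ι i = 𝟙 M) :
    IsPiecewiseDomain (fun i => ofEnd.{u} (p i ≫ ι i)) ↔ ExtNoZeroDivisors.{u} X := by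
  constructor
  · rintro ⟨-, h⟩ l m q a b n hn x y hxy
    have h0 := h q m l (DirectSum.of _ b (extConj (p m) y (ι q)))
      (DirectSum.of _ a (extConj (p l) x (ι m))) (ofEnd_mul_of_mul_ofEnd h1 y)
      (ofEnd_mul_of_mul_ofEnd h1 x) (by
        rw [of_mul_of_ext _ _ hn, extConj_comp_extConj _ _ _ _ _ (h1 m), hxy, extConj_zero,
          map_zero])
    have hz : ∀ (n : ℕ) (z : Ext.{u} M M n),
        DirectSum.of (fun n : ℕ => Ext.{u} M M n) n z = 0 → z = 0 := fun n z hz =>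
      DirectSum.of_injective n (hz.trans (map_zero _).symm)
    rcases h0 with h0 | h0
    · exact Or.inr ((extConj_eq_zero_iff h1 y).1 (hz _ _ h0))
    · exact Or.inl ((extConj_eq_zero_iff h1 x).1 (hz _ _ h0))
  · refine fun h => ⟨completeOrthogonalIdempotents_ofEnd h1 h2 h3, fun i j l x y hx hy hxy => ?_⟩
    by_contra! hne
    obtain ⟨a, ha, ha'⟩ := exists_lowest hne.1
    obtain ⟨b, hb, hb'⟩ := exists_lowest hne.2
    have hxa : x a = extConj (p j) (extConj (ι j) (x a) (p i)) (ι i) := by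
      rw [extConj_extConj, ← ofEnd_mul_mul_ofEnd, hx]
    have hyb : y b = extConj (p l) (extConj (ι l) (y b) (p j)) (ι j) := by
      rw [extConj_extConj, ← ofEnd_mul_mul_ofEnd, hy]
    have h0 : (y b).comp (x a) (Nat.add_comm b a) = 0 := by
      refine (directSum_mul_apply_lowest x y ha' hb').symm.trans ?_
      rw [hxy]; rfl
    rw [hxa, hyb, extConj_comp_extConj _ _ _ _ _ (h1 j), extConj_eq_zero_iff h1] at h0
    rcases h _ _ _ _ _ _ _ _ _ h0 with h' | h'
    · exact hb (by rw [hyb, h', extConj_zero])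
    · exact ha (by rw [hxa, h', extConj_zero])

theorem isPrimeRing_extRing (hr : 1 ≤ r) (h1 : ∀ i, ι i ≫ p i = 𝟙 _)
    (h : IsPiecewiseDomain (fun i => ofEnd.{u} (p i ≫ ι i)))
    (hX : ∀ l m, ∃ (n : ℕ) (x : Ext.{u} (X l) (X m) n), x ≠ 0) : IsPrimeRing (ExtRing.{u} M) := by
  refine isPrimeRing_of_isPiecewiseDomain hr h fun i j => ?_
  -- The indices are exchanged because the corner `e i R e j` consists of classes from `X j` to `X
  -- i`.
  obtain ⟨n, x, hx⟩ := hX j i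
  refine ⟨DirectSum.of _ n (extConj (p j) x (ι i)), fun h0 => hx ?_, ofEnd_mul_of_mul_ofEnd h1 x⟩
  exact (extConj_eq_zero_iff h1 x).1 (DirectSum.of_injective n (h0.trans (map_zero _).symm))

end

/-! ### Simple quotients detecting nonsurjective morphisms. -/

namespace GrMod

variable {Λ : Type u} [Ring Λ] {𝒜 : ℕ → AddSubgroup Λ} [GradedRing 𝒜]

/-- The quotient of a module generated in degree `0` by the elements whose component of degree `0`
lies in a given submodule of `M₀`, which is concentrated in degree `0`. -/
def zeroQuotient (M : GrMod 𝒜) (hM : M.GeneratedIn 0)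
    (W : @Submodule (𝒜 0)ᵐᵒᵖ (M.grade 0) _ _ (modZero M)) : GrMod 𝒜 where
  carrier := M.carrier ⧸ M.zeroComap hM W
  grade n := if n = 0 then ⊤ else ⊥
  isInternal := by
    refine isInternal_of_proj _ (fun n => if n = 0 then AddMonoidHom.id _ else 0) ?_ ?_ ?_
    · intro n x hx
      split_ifs at hx ⊢
      · rfl
      · exact ((AddSubgroup.mem_bot).1 hx).symm
    · intro m n x hmn hx
      by_cases hn : n = 0
      · subst hn
        rw [if_neg hmn] at hx
        exact (AddSubgroup.mem_bot).1 hx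
      · rw [if_neg hn]; rfl
    · intro x
      refine AddSubgroup.mem_iSup_of_mem 0 ?_
      rw [if_pos rfl]
      trivial
  smul_mem := by
    intro i n a x ha hx
    by_cases hn : n = 0
    · subst hn
      by_cases hi : i = 0
      · subst hi
        rw [if_pos (by simp)]; trivial
      · rw [if_neg (by simpa using hi), AddSubgroup.mem_bot]
        obtain ⟨x, rfl⟩ := Submodule.mkQ_surjective _ x
        rw [← map_smul, Submodule.mkQ_apply, Submodule.Quotient.mk_eq_zero]
        have h : M.component 0 (MulOpposite.op a • x) = 0 := by
          rw [hM.component_zero_smul, DirectSum.decompose_of_mem_ne 𝒜 ha hi]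
          simp
        have := sub_component_mem_zeroComap (hM := hM) (W := W) (MulOpposite.op a • x)
        rwa [h, sub_zero] at this
    · rw [if_neg hn, AddSubgroup.mem_bot] at hx
      rw [hx, smul_zero]
      exact zero_mem _

theorem zeroQuotient_concentrated (M : GrMod 𝒜) (hM : M.GeneratedIn 0)
    (W : @Submodule (𝒜 0)ᵐᵒᵖ (M.grade 0) _ _ (modZero M)) :
    (M.zeroQuotient hM W).Concentrated := by
  change (if (0 : ℤ) = 0 then ⊤ else ⊥ : AddSubgroup (M.zeroQuotient hM W).carrier) = ⊤
  exact if_pos rfl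

/-- The projection onto `M.zeroQuotient hM W`. -/
def zeroQuotientMk (M : GrMod 𝒜) (hM : M.GeneratedIn 0)
    (W : @Submodule (𝒜 0)ᵐᵒᵖ (M.grade 0) _ _ (modZero M)) : M ⟶ M.zeroQuotient hM W :=
  homOfConcentrated hM (T := M.zeroQuotient hM W)
    (M.zeroQuotient_concentrated hM W) (M.zeroComap hM W).mkQ

/-- A submodule `V` strictly above `zeroComap` contains every element without component of degree
`0`, so it must be larger than `W` in degree `0`. By maximality it contains `M₀`, which generates
`M`. -/
theorem zeroQuotient_isSimpleModule {M : GrMod 𝒜} (hM : M.GeneratedIn 0)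
    {W : @Submodule (𝒜 0)ᵐᵒᵖ (M.grade 0) _ _ (modZero M)} (hW : IsCoatom W) :
    IsSimpleModule Λᵐᵒᵖ (M.zeroQuotient hM W).carrier := by
  let _ := modZero M
  refine isSimpleModule_iff_isCoatom.2 ⟨fun h => hW.1 ?_, fun V hV => ?_⟩
  · refine eq_top_iff.2 fun x _ => ?_
    rw [← mem_zeroComap_of_mem (hM := hM) x.2, h]
    trivial
  · let V₀ : Submodule (𝒜 0)ᵐᵒᵖ (M.grade 0) :=
      { carrier := {x | (x : M.carrier) ∈ V}
        zero_mem' := V.zero_mem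
        add_mem' := fun hx hy => V.add_mem hx hy
        smul_mem' := fun s x hx => V.smul_mem (MulOpposite.op (s.unop : Λ)) hx }
    obtain ⟨v, hv, hvW⟩ := SetLike.exists_of_lt hV
    have hV₀ : V₀ = ⊤ := by
      refine hW.2 _ (lt_of_le_of_ne (fun x hx => hV.le ?_) fun h => ?_)
      · exact (mem_zeroComap_of_mem x.2).2 hx
      · have hv0 : M.component 0 v ∈ V := by
          have := V.sub_mem hv (hV.le (sub_component_mem_zeroComap v))
          rwa [sub_sub_cancel] at this
        refine hvW (mem_zeroComap.2 ?_)
        rw [h]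
        exact hv0
    rw [eq_top_iff, ← hM, Submodule.span_le]
    intro x hx
    have : (⟨x, hx⟩ : M.grade 0) ∈ V₀ := by rw [hV₀]; trivial
    exact this

/-- A morphism into a module generated in degree `0` that is not surjective is annihilated by a
morphism onto a simple module. -/
theorem exists_simple_quotient [IsSemisimpleRing (𝒜 0)] {M N : GrMod 𝒜} (hN : N.GeneratedIn 0)
    {f : M ⟶ N} (hf : ¬ Surj f) : ∃ (T : GrMod 𝒜) (g : N ⟶ T),
      IsSimpleModule Λᵐᵒᵖ T.carrier ∧ Surj g ∧ ∀ x, lin g (lin f x) = 0 := by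
  let _ := modZero M
  let _ := modZero N
  -- Surjectivity is decided in degree `0`, where a proper image lies in a maximal `Λ₀`-submodule
  -- `W`.
  rcases eq_top_or_exists_le_coatom (LinearMap.range (zeroLin f)) with h | ⟨W, hW, hle⟩
  · exfalso
    refine hf (LinearMap.range_eq_top.1 (eq_top_iff.2 ?_))
    rw [← hN, Submodule.span_le]
    intro x hx
    obtain ⟨y, hy⟩ := LinearMap.range_eq_top.1 h ⟨x, hx⟩
    exact ⟨y, congrArg Subtype.val hy⟩
  · refine ⟨N.zeroQuotient hN W, N.zeroQuotientMk hN W, zeroQuotient_isSimpleModule hN hW,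
      Submodule.mkQ_surjective _, fun x => ?_⟩
    refine (Submodule.Quotient.mk_eq_zero _).2 (mem_zeroComap.2 (hle ?_))
    refine ⟨⟨M.component 0 x, M.component_mem 0 x⟩, Subtype.ext ?_⟩
    exact lin_component f 0 x

end GrMod

/-! ### The conditions of the theorem for the modules `S i`. -/

section

open Abelian GrMod

variable {Λ : Type u} [Ring Λ] {𝒜 : ℕ → AddSubgroup Λ} {r : ℕ} (S : Fin r → GrMod 𝒜)

/-- The inclusions of the summands of `directSum S`. -/
def sumι (i : Fin r) : (S i).toMod ⟶ directSum S :=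
  ModuleCat.ofHom (DirectSum.lof Λᵐᵒᵖ (Fin r) (fun i => (S i).carrier) i)

/-- The projections onto the summands of `directSum S`. -/
def sumπ (i : Fin r) : directSum S ⟶ (S i).toMod :=
  ModuleCat.ofHom (DirectSum.component Λᵐᵒᵖ (Fin r) (fun i => (S i).carrier) i)

theorem sumι_sumπ_same (i : Fin r) : sumι S i ≫ sumπ S i = 𝟙 _ := by
  refine ModuleCat.hom_ext (LinearMap.ext fun x => ?_)
  exact DirectSum.component.lof_self Λᵐᵒᵖ (M := fun i => (S i).carrier) i x

theorem sumι_sumπ_ne (i j : Fin r) (h : i ≠ j) : sumι S i ≫ sumπ S j = 0 := by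
  refine ModuleCat.hom_ext (LinearMap.ext fun x => ?_)
  exact DirectSum.of_eq_of_ne (β := fun i => (S i).carrier) _ _ _ h.symm

theorem sum_sumπ_sumι : ∑ i, sumπ S i ≫ sumι S i = 𝟙 (directSum S) := by
  refine ModuleCat.hom_ext (LinearMap.ext fun x => ?_)
  rw [ModuleCat.hom_sum, LinearMap.sum_apply]
  exact DirectSum.sum_univ_of x

theorem idem_eq : idem S = fun i => ofEnd (sumπ S i ≫ sumι S i) := by
  funext i
  exact congrArg ofEnd (ModuleCat.ofHom_comp _ _)

theorem isPiecewiseDomain_idem_iff : IsPiecewiseDomain (idem S) ↔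
    ExtNoZeroDivisors.{u} fun i => (S i).toMod := by
  rw [idem_eq]
  exact isPiecewiseDomain_ofEnd_iff (sumι_sumπ_same S) (sumι_sumπ_ne S) (sum_sumπ_sumι S)

variable [GradedRing 𝒜] [IsSemisimpleRing (𝒜 0)]

variable {S}

/-- All Ext classes between the `S i` are classes of graded morphisms, so condition (a) becomes a
statement about composites `F^j(f) ≫ g`. -/
theorem extNoZeroDivisors_iff (hK : ∀ l, (S l).LinearSyzygies) (hS : ∀ l, (S l).Concentrated) :
    ExtNoZeroDivisors.{u} (fun i => (S i).toMod) ↔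
      ∀ (l m q : Fin r) (i j : ℕ) (f : (Fpow 𝒜 i).obj (S l) ⟶ S m)
        (g : (Fpow 𝒜 j).obj (S m) ⟶ S q), Nonzero f → Nonzero g →
          Nonzero ((Fpow 𝒜 j).map f ≫ g) := by
  constructor
  · intro h l m q i j f g hf hg
    by_contra h0
    rw [← comp_eq_zero_iff (hK l) (hK m) (hS q) rfl] at h0
    rcases h _ _ _ _ _ _ _ _ _ h0 with h1 | h1
    · exact (syzygyClass_comp_eq_zero_iff (hK l) (hS m) f).1 h1 hf
    · exact (syzygyClass_comp_eq_zero_iff (hK m) (hS q) g).1 h1 hg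
  · intro h l m q a b n hn x y hxy
    obtain ⟨f, rfl⟩ := exists_extClass_eq (hK l) (hS m) x
    obtain ⟨g, rfl⟩ := exists_extClass_eq (hK m) (hS q) y
    rw [comp_eq_zero_iff (hK l) (hK m) (hS q)] at hxy
    rw [syzygyClass_comp_eq_zero_iff (hK l) (hS m), syzygyClass_comp_eq_zero_iff (hK m) (hS q)]
    by_contra! hne
    exact hxy (h l m q a b f g hne.1 hne.2)

theorem PreservesSurjections.isPiecewiseDomain (hK : ∀ l, (S l).LinearSyzygies)
    (hS : ∀ l, (S l).Concentrated) (h : PreservesSurjections S) : IsPiecewiseDomain (idem S) := by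
  rw [isPiecewiseDomain_idem_iff, extNoZeroDivisors_iff hK hS]
  intro l m q i j f g hf hg h0
  refine hg (LinearMap.ext fun y => ?_)
  obtain ⟨x, rfl⟩ := h i l m f hf j y
  exact LinearMap.congr_fun h0 x

theorem preservesSurjections_of_isPiecewiseDomain (hK : ∀ l, (S l).LinearSyzygies)
    (hS : ∀ l, (S l).Concentrated) (hq : ContainsSimpleQuotients S)
    (h : IsPiecewiseDomain (idem S)) : PreservesSurjections S := by
  rw [isPiecewiseDomain_idem_iff, extNoZeroDivisors_iff hK hS] at h
  intro i l m f hf j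
  by_contra hj
  obtain ⟨T, g, hT, hg, hfg⟩ := exists_simple_quotient (hK m j) hj
  obtain ⟨p, ⟨e⟩⟩ := hq j m T g hT hg
  have he : ∀ x, lin e.inv (lin e.hom x) = x := fun x => by
    rw [← lin_comp, e.hom_inv_id, lin_id]
  -- The morphism `g ≫ e.hom` is nonzero, but its composite with `F^j(f)` vanishes.
  refine h l m p i j f (g ≫ e.hom) hf (fun h0 => ?_) (LinearMap.ext fun x => ?_)
  · have := IsSimpleModule.nontrivial Λᵐᵒᵖ T.carrier
    obtain ⟨t, ht⟩ := exists_ne (0 : T.carrier)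
    obtain ⟨x, rfl⟩ := hg t
    refine ht ?_
    rw [← he (lin g x), ← lin_comp g, h0]
    exact map_zero _
  · change lin e.hom (lin g (lin _ x)) = 0
    rw [hfg, map_zero]

theorem exists_ext_ne_zero (hK : ∀ l, (S l).LinearSyzygies) (hS : ∀ l, (S l).Concentrated)
    (hs : ∀ l, IsSimpleModule Λᵐᵒᵖ (S l).carrier)
    (h : ∀ l m : Fin r, l ≠ m → ∃ (i : ℕ) (f : (Fpow 𝒜 i).obj (S l) ⟶ S m), Nonzero f)
    (l m : Fin r) : ∃ (n : ℕ) (x : Ext.{u} (S l).toMod (S m).toMod n), x ≠ 0 := by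
  have h' : ∃ (i : ℕ) (f : (Fpow 𝒜 i).obj (S l) ⟶ S m), Nonzero f := by
    by_cases hlm : l = m
    · subst hlm
      -- The hypothesis links only distinct indices; on the diagonal the identity in degree `0`
      -- serves.
      refine ⟨0, 𝟙 _, fun h0 => ?_⟩
      have := IsSimpleModule.nontrivial Λᵐᵒᵖ (S l).carrier
      obtain ⟨t, ht⟩ := exists_ne (0 : (S l).carrier)
      exact ht (LinearMap.congr_fun h0 t)
    · exact h l m hlm
  obtain ⟨n, f, hf⟩ := h'
  exact ⟨n, _, fun h0 => (syzygyClass_comp_eq_zero_iff (hK l) (hS m) f).1 h0 hf⟩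

end

end KoszulExt

end

theorem theorem3p7 {Λ : Type u} [Ring Λ] (𝒜 : ℕ → AddSubgroup Λ) [GradedRing 𝒜]
    [IsSemisimpleRing (𝒜 0)] {r : ℕ} (hr : 1 ≤ r) (S : Fin r → KoszulExt.GrMod 𝒜)
    (hsimple : ∀ l, IsSimpleModule Λᵐᵒᵖ (S l).carrier) (hKoszul : ∀ l, (S l).IsKoszul) :
    -- the three equivalent conditions, when the simple quotients of all `F^j(S m)` occur in `S`
    (KoszulExt.ContainsSimpleQuotients S →
      [KoszulExt.IsPiecewiseDomain (KoszulExt.idem S),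
        KoszulExt.PreservesSurjections S,
        KoszulExt.HasKoszulKernels S].TFAE) ∧
    -- the implications that do not need this
    (KoszulExt.PreservesSurjections S ↔ KoszulExt.HasKoszulKernels S) ∧
    (KoszulExt.PreservesSurjections S → KoszulExt.IsPiecewiseDomain (KoszulExt.idem S)) ∧
    -- primeness
    (KoszulExt.IsPiecewiseDomain (KoszulExt.idem S) →
      (∀ l m : Fin r, l ≠ m → ∃ (i : ℕ) (f : (KoszulExt.GrMod.Fpow 𝒜 i).obj (S l) ⟶ S m),
        KoszulExt.GrMod.Nonzero f) →
      KoszulExt.IsPrimeRing (KoszulExt.ExtRing (KoszulExt.directSum S))) := by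
  have hK := fun l => KoszulExt.GrMod.isKoszul_iff_linearSyzygies.1 (hKoszul l)
  have hS := fun l => KoszulExt.GrMod.concentrated_of_isSimpleModule (hKoszul l).1 (hsimple l)
  have hbc := KoszulExt.preservesSurjections_iff S hsimple hKoszul
  refine ⟨fun hq => ?_, hbc, fun h => h.isPiecewiseDomain hK hS, fun h hconn => ?_⟩
  · tfae_have 1 → 2 := KoszulExt.preservesSurjections_of_isPiecewiseDomain hK hS hq
    tfae_have 2 → 1 := fun h => h.isPiecewiseDomain hK hS
    tfae_have 2 ↔ 3 := hbc
    tfae_finish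
  · rw [KoszulExt.idem_eq] at h
    exact KoszulExt.isPrimeRing_extRing hr (KoszulExt.sumι_sumπ_same S) h
      (KoszulExt.exists_ext_ne_zero hK hS hsimple hconn)
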